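/- **Conventions.** For $n,s\ge 1$ and $\delta>0$ write $\ell_\delta(n,s)=\min\{n^{-(1/2+\delta)},\,s^{-(1+\delta)}\}$. *Polynomial-time tests.* A test is a $\{0,1\}$-valued function of $n$ data vectors in dimension $d$. Given sequences $d=d_n$, $s=s_n$, a sequence of tests $(\psi_n)$ is a polynomial-time test if a single deterministic Turing machine, which receives $s_n$ (in unary) and the $n\times d_n$ data table and runs in time polynomial in the length of its input, outputs $\psi_n$ for every $n$. Tables of signs are written exactly; real data $z$ are read in fixed-point precision, as the integers $\lfloor 2^{t}z\rfloor$ in binary (with sign), where $t=p(n+d_n)$ for some polynomial $p$ belonging to the test. *Sparse PCA conjecture with exponent $\delta$.* For $\sigma>0$ let $\mathcal S_\sigma=\{\mathrm I+\sigma 1_I1_I^{T}: I\subseteq\{1,\dots,d\},\ |I|=s\}$, where $1_I\in\mathbb R^d$ is the indicator vector of $I$, and let $\mathbb P_{\Sigma,n}$ be the law of $n$ i.i.d. samples from $N(0,\Sigma)$ in $\mathbb R^{d}$. The conjecture says: there is a constant $\eta>0$ such that for all sequences $d_n$, $s_n\ge 1$ with $s_n=o(\sqrt{d_n})$ and all $\sigma_n$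 with $0<\sigma_n\le \eta\,\ell_\delta(n,s_n)$ for all large $n$, every polynomial-time test $\psi$ satisfies $$\liminf_{n\to\infty}\Big[\mathbb P_{\mathrm I,n}(\psi=1)+\max_{\Sigma\in\mathcal S_{\sigma_n}}\mathbb P_{\Sigma,n}(\psi=0)\Big]\ge\tfrac14 .$$ *Ising model and clique detection.* For a symmetric matrix $\Theta=(\theta_{ij})_{d\times d}$ with zero diagonal let $\mathbb P_{\Theta,n}$ be the law of $n$ i.i.d. samples from the distribution on $\{\pm1\}^d$ with probability mass function proportional to $\exp\big(\sum_{i,j=1}^d\theta_{ij}x_ix_j\big)$; $\mathbb P_{0,n}$ is the case $\Theta=0$. Let $G(\Theta)$ be the graph on $\{1,\dots,d\}$ with edges $\{(i,j):\theta_{ij}\ne0\}$. For a graph $G_*$ let $\mathcal G_1(G_*)$ be the set of all graphs on $\{1,\dots,d\}$ that contain a subgraph isomorphic to $G_*$, and for $\theta>0$ put $$\mathcal S(\mathcal G_1(G_*),\theta)=\Big\{\Theta=\Theta^{T}:\ \theta_{ii}=0,\ G(\Theta)\in\mathcal G_1(G_*),\ \|\Theta\|_F\le\tfrac12,\ \theta_{ij}\ge\theta\text{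 for every edge }(i,j)\text{ of }G(\Theta)\Big\}.$$ **Theorem (computational hardness of Ising clique detection).** Let $\delta>0$ and suppose that the sparse PCA conjecture with exponent $\delta$ holds. Then there is a constant $\eta>0$ such that for all sequences $d_n$, $s_n\ge2$ with $s_n=o(\sqrt{d_n})$ and all $\theta_n$ with $$0<\theta_n\le\eta\,\big[n^{-(1/2+\delta)}\wedge s_n^{-(1+\delta)}\big]\quad\text{for all large }n,$$ every polynomial-time test $\psi$ satisfies, with $G_*$ the $s_n$-clique, $$\liminf_{n\to\infty}\Big[\mathbb P_{0,n}(\psi=1)+\max_{\Theta\in\mathcal S(\mathcal G_1(G_*),\theta_n)}\mathbb P_{\Theta,n}(\psi=0)\Big]\ge\tfrac14 .$$ -/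

import Mathlib

open MeasureTheory ProbabilityTheory Filter
open scoped ENNReal Matrix Asymptotics

noncomputable section

namespace IsingDetection

/-! ### Polynomial-time tests

A test reads a finite data table.  The table is written as a string over a finite alphabet and is
processed by a Turing machine (Mathlib's `Turing.FinTM2`) running in time polynomial in the length
of that string. -/

/-- The alphabet in which data tables are written. -/
inductive Symb : Type
  | tick
  | newRow
  | sign (nonneg : Bool)
  | digit (b : Bool)
  deriving DecidableEq, Fintype

/-- A table with `n` rows, together with the sparsity level `s` (in unary):
`s` ticks, then each row, opened by the symbol `newRow`. -/
def encodeTable {A : Type} (encodeEntry : A → List Symb) (x : ℕ × List (List A)) : List Symb :=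
  List.replicate x.1 Symb.tick ++ x.2.flatMap fun row => Symb.newRow :: row.flatMap encodeEntry

/-- An integer: its sign, followed by the binary digits of its absolute value. -/
def encodeInt (m : ℤ) : List Symb :=
  Symb.sign (decide (0 ≤ m)) :: m.natAbs.bits.map Symb.digit

/-- A spin in `{1, -1}`: its sign. -/
def encodeSpin (u : ℤˣ) : List Symb :=
  [Symb.sign (decide (u = 1))]

/-- A Boolean function of tables with entries in `A` (and of the sparsity level) which is computed
by a Turing machine in polynomial time. -/
def IsPolyTime {A : Type} (encodeEntry : A → List Symb) (f : ℕ × List (List A) → Bool) : Prop :=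
  Nonempty (Turing.TM2ComputableInPolyTime (encodeTable encodeEntry) Computability.encodeBool f)

/-- The list of rows of a table given as a function. -/
def tableRows {n d : ℕ} {A : Type} (x : Fin n → Fin d → A) : List (List A) :=
  List.ofFn fun i => List.ofFn (x i)

/-- A sequence of tests `ψ n`, each deciding from `n` vectors of spins in dimension `d n`
(`true` stands for the value `1`, `false` for the value `0`), is a polynomial-time test
if a single polynomial-time algorithm, which is given `s n` and the samples, computes all `ψ n`. -/
def IsPolyTimeSpinTest {d : ℕ → ℕ} (s : ℕ → ℕ)
    (ψ : ∀ n, (Fin n → Fin (d n) → ℤˣ) → Bool) : Prop :=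
  ∃ f : ℕ × List (List ℤˣ) → Bool, IsPolyTime encodeSpin f ∧
    ∀ n x, ψ n x = f (s n, tableRows x)

/-- The real number `x` in fixed-point precision `t`: the integer part of `2 ^ t * x`. -/
def quantize (t : ℕ) (x : ℝ) : ℤ := ⌊(2 : ℝ) ^ t * x⌋

/-- A sequence of tests `ψ n`, each deciding from `n` real vectors in dimension `d n`, is a
polynomial-time test if a single polynomial-time algorithm computes all `ψ n` from `s n` and the
samples, the latter read with a number of binary places that is a polynomial in `n + d n`. -/
def IsPolyTimeRealTest {d : ℕ → ℕ} (s : ℕ → ℕ)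
    (ψ : ∀ n, (Fin n → EuclideanSpace ℝ (Fin (d n))) → Bool) : Prop :=
  ∃ (f : ℕ × List (List ℤ) → Bool) (p : Polynomial ℕ), IsPolyTime encodeInt f ∧
    ∀ n z, ψ n z = f (s n, tableRows fun i j => quantize (p.eval (n + d n)) (z i j))

/-! ### Sparse principal component analysis -/

/-- The `0`-`1` indicator vector of a set of coordinates. -/
def indicatorVec {d : ℕ} (I : Finset (Fin d)) : Fin d → ℝ := fun i => if i ∈ I then 1 else 0

/-- The covariance matrices `I + σ 1_S 1_Sᵀ` of the spiked model, `S` a set of `s` coordinates. -/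
def spikedCovariances (d s : ℕ) (σ : ℝ) : Set (Matrix (Fin d) (Fin d) ℝ) :=
  {S | ∃ I : Finset (Fin d), I.card = s ∧
    S = 1 + σ • Matrix.vecMulVec (indicatorVec I) (indicatorVec I)}

/-- The law of `n` independent samples from `N(0, S)`. -/
def gaussianSample {d : ℕ} (S : Matrix (Fin d) (Fin d) ℝ) (n : ℕ) :
    Measure (Fin n → EuclideanSpace ℝ (Fin d)) :=
  Measure.pi fun _ => multivariateGaussian 0 S

/-- Type I error plus worst-case type II error of the test `ψ` for the sparse PCA problem. -/
def pcaRisk {n d : ℕ} (s : ℕ) (σ : ℝ) (ψ : (Fin n → EuclideanSpace ℝ (Fin d)) → Bool) : ℝ≥0∞ :=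
  gaussianSample 1 n {z | ψ z = true} +
    ⨆ S ∈ spikedCovariances d s σ, gaussianSample S n {z | ψ z = false}

/-- The signal level `n^{-(1/2+δ)} ∧ s^{-(1+δ)}`. -/
def signalLevel (δ : ℝ) (n s : ℕ) : ℝ :=
  min ((n : ℝ) ^ (-(1 / 2 + δ))) ((s : ℝ) ^ (-(1 + δ)))

/-- The hardness conjecture for sparse PCA with exponent `δ`: there is a constant `η > 0` such that,
for all dimensions `d n` and sparsity levels `1 ≤ s n = o(√(d n))` and all signal strengths
`0 < σ n ≤ η (n^{-(1/2+δ)} ∧ s^{-(1+δ)})`, every polynomial-time test has asymptotic summed error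
at least `1/4`. -/
def SparsePCAHardness (δ : ℝ) : Prop :=
  ∃ η : ℝ, 0 < η ∧ ∀ (d s : ℕ → ℕ) (σ : ℕ → ℝ),
    (∀ n, 1 ≤ s n) →
    (fun n => (s n : ℝ)) =o[atTop] (fun n => √(d n : ℝ)) →
    (∀ᶠ n in atTop, 0 < σ n ∧ σ n ≤ η * signalLevel δ n (s n)) →
    ∀ ψ : ∀ n, (Fin n → EuclideanSpace ℝ (Fin (d n))) → Bool, IsPolyTimeRealTest s ψ →
      1 / 4 ≤ liminf (fun n => pcaRisk (s n) (σ n) (ψ n)) atTop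

/-! ### The Ising model and the detection problem -/

/-- The unnormalized weight `exp (∑_{i,j} θ_{ij} x_i x_j)` of a spin configuration. -/
def isingWeight {d : ℕ} (Θ : Matrix (Fin d) (Fin d) ℝ) (x : Fin d → ℤˣ) : ℝ :=
  Real.exp (∑ i, ∑ j, Θ i j * ((x i : ℤ) : ℝ) * ((x j : ℤ) : ℝ))

/-- The partition function. -/
def partitionFunction {d : ℕ} (Θ : Matrix (Fin d) (Fin d) ℝ) : ℝ :=
  ∑ x : Fin d → ℤˣ, isingWeight Θ x

/-- The zero-field Ising model with interaction matrix `Θ`. -/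
def isingMeasure {d : ℕ} (Θ : Matrix (Fin d) (Fin d) ℝ) : Measure (Fin d → ℤˣ) :=
  ∑ x : Fin d → ℤˣ, ENNReal.ofReal (isingWeight Θ x / partitionFunction Θ) • Measure.dirac x

/-- The law of `n` independent samples from the Ising model. -/
def isingSample {d : ℕ} (Θ : Matrix (Fin d) (Fin d) ℝ) (n : ℕ) :
    Measure (Fin n → Fin d → ℤˣ) :=
  Measure.pi fun _ => isingMeasure Θ

/-- The graph whose edges are the non-zero (off-diagonal) entries of a symmetric matrix. -/
def interactionGraph {d : ℕ} (Θ : Matrix (Fin d) (Fin d) ℝ) : SimpleGraph (Fin d) :=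
  SimpleGraph.fromRel fun i j => Θ i j ≠ 0

/-- The graphs on `d` vertices that contain a subgraph isomorphic to `G₀`. -/
def graphsContaining {V : Type} (G₀ : SimpleGraph V) (d : ℕ) : Set (SimpleGraph (Fin d)) :=
  {G | G₀.IsContained G}

/-- The parameter space of interaction matrices whose graph lies in `𝒢`, with minimal signal
strength `θ` and Frobenius norm at most `1/2`. -/
def parameterSpace {d : ℕ} (𝒢 : Set (SimpleGraph (Fin d))) (θ : ℝ) :
    Set (Matrix (Fin d) (Fin d) ℝ) :=
  {Θ | Θ.IsSymm ∧ (∀ i, Θ i i = 0) ∧ interactionGraph Θ ∈ 𝒢 ∧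
    √(∑ i, ∑ j, Θ i j ^ 2) ≤ 1 / 2 ∧
    ∀ i j, (interactionGraph Θ).Adj i j → θ ≤ Θ i j}

/-- Type I error plus worst-case type II error of the test `ψ` for detecting, in an Ising model,
a subgraph isomorphic to `G₀`. -/
def isingRisk {V : Type} (G₀ : SimpleGraph V) {n d : ℕ} (θ : ℝ)
    (ψ : (Fin n → Fin d → ℤˣ) → Bool) : ℝ≥0∞ :=
  isingSample 0 n {x | ψ x = true} +
    ⨆ Θ ∈ parameterSpace (graphsContaining G₀ d) θ, isingSample Θ n {x | ψ x = false}

end IsingDetection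

end

/-! A spin test applied to the coordinatewise signs of Gaussian data is a sparse PCA test, so it
suffices that the signs of a spiked Gaussian sample be close in total variation to a sample from an
Ising model on a clique. Both laws are mixtures over a Gaussian variable `g`. Writing the spiked
vector as white noise plus `g` times a multiple of the indicator of `I`, its signs are independent
given `g`, with mean `signMean (r * g)` on `I` (`map_signVec_spiked`). On the Ising side, Gaussian
linearization of the square (`integral_exp_gaussianReal`) turns `exp (θ (∑ x i) ^ 2)` into an
average of product weights in the field `w = √τ * g`, with `θ = τ / (2 * (1 + s * τ))`. The spike
strength `π / 2 * τ` makes the mean sign equal to `w` up to `|w| ^ 3` (`signMean_bounds`). For fixed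
`g`, the scaled squared distance of the two product weights is a combination of three `s`-th powers
whose low-order terms cancel, leaving `O(s w ^ 6 + s ^ 2 w ^ 8)` times `exp (s w ^ 2)`
(`pow_sub_two_pow_add_pow_le`). Jensen's inequality over `g` gives a chi-square divergence `O(s τ ^
3 + s ^ 2 τ ^ 4)` (`chiSq_signVec_ising_le`), which is `O(θ ^ 2)` when `s * τ` is bounded. Over `n`
samples the exponent is `O(n θ ^ 2) = O(n ^ (-2δ))`, so the total variation error vanishes. The
reduction is computable: in the chosen encoding, taking signs means deleting the binary digits, and
a Turing machine can filter its input before running the given one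
(`TM2ComputableInPolyTime.of_filter`). -/

namespace IsingDetection

/-! ### A Turing machine that filters its input -/

namespace FilterTM

open Turing Turing.TM2 Function

variable (tm : FinTM2)

/-- The stack alphabets of a machine with an additional stack for input symbols. -/
abbrev Alph (o : Option tm.K) : Type := tm.Γ (o.getD tm.k₀)

/-- The internal state together with a register for an input symbol. -/
abbrev State : Type := Option (tm.Γ tm.k₀) × tm.σ

/-- The program labels, with two labels for the two passes of the filter. -/
abbrev Label : Type := tm.Λ ⊕ Bool

variable {tm}

/-- A statement of the original machine, executed by the extended one. -/
def liftStmt : TM2.Stmt tm.Γ tm.Λ tm.σ → TM2.Stmt (Alph tm) (Label tm) (State tm)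
  | .push k f q => .push (some k) (fun v => f v.2) (liftStmt q)
  | .peek k f q => .peek (some k) (fun v a => (v.1, f v.2 a)) (liftStmt q)
  | .pop k f q => .pop (some k) (fun v a => (v.1, f v.2 a)) (liftStmt q)
  | .load f q => .load (fun v => (v.1, f v.2)) (liftStmt q)
  | .branch f q₁ q₂ => .branch (fun v => f v.2) (liftStmt q₁) (liftStmt q₂)
  | .goto f => .goto fun v => .inl (f v.2)
  | .halt => .halt

/-- The program of the extended machine: the label `inr false` moves the input symbols that
satisfy `p` to the additional stack, the label `inr true` moves them back. -/
def prog (p : tm.Γ tm.k₀ → Bool) (g : tm.Γ tm.k₀) :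
    Label tm → TM2.Stmt (Alph tm) (Label tm) (State tm)
  | .inl l => liftStmt (tm.m l)
  | .inr false =>
    .pop (some tm.k₀) (fun v a => (a, v.2)) <|
      .branch (fun v => v.1.isSome)
        (.branch (fun v => p (v.1.getD g))
          (.push none (fun v => v.1.getD g) (.goto fun _ => .inr false))
          (.goto fun _ => .inr false))
        (.goto fun _ => .inr true)
  | .inr true =>
    .pop none (fun v a => (a, v.2)) <|
      .branch (fun v => v.1.isSome)
        (.push (some tm.k₀) (fun v => v.1.getD g) (.goto fun _ => .inr true))
        (.goto fun _ => .inl tm.main)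

variable (tm) in
/-- The machine that discards the input symbols violating `p` and then runs `tm`. -/
def machine (p : tm.Γ tm.k₀ → Bool) (g : tm.Γ tm.k₀) : FinTM2 :=
  letI := tm.kFin
  letI := tm.ΛFin
  letI := tm.σFin
  letI := tm.Γk₀Fin
  { K := Option tm.K
    k₀ := some tm.k₀
    k₁ := some tm.k₁
    Γ := Alph tm
    Λ := Label tm
    main := .inr false
    σ := State tm
    initialState := (none, tm.initialState)
    Γk₀Fin := tm.Γk₀Fin
    m := prog p g }

/-- The stacks of the original machine, followed by an empty additional stack. -/
def liftStk (S : ∀ k, List (tm.Γ k)) : ∀ o, List (Alph tm o)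
  | none => []
  | some k => S k

/-- A configuration of the original machine, as one of the extended machine. -/
def liftCfg (c : TM2.Cfg tm.Γ tm.Λ tm.σ) : TM2.Cfg (Alph tm) (Label tm) (State tm) :=
  ⟨c.l.map .inl, (none, c.var), liftStk c.stk⟩

theorem liftStk_update (S : ∀ k, List (tm.Γ k)) (k : tm.K) (a : List (tm.Γ k)) :
    update (liftStk S) (some k) a = liftStk (update S k a) := by
  funext o
  cases o with
  | none => simp [liftStk]
  | some j =>
    by_cases h : j = k
    · subst h; simp [liftStk]
    · simp [liftStk, h]

/-- Lifted statements touch neither the register nor the additional stack, so the simulation is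
exact, step for step. -/
theorem stepAux_liftStmt (q : TM2.Stmt tm.Γ tm.Λ tm.σ) (v : tm.σ) (S : ∀ k, List (tm.Γ k)) :
    stepAux (liftStmt q) ((none, v) : State tm) (liftStk S) = liftCfg (stepAux q v S) := by
  induction q generalizing v S with
  | push k f q ih =>
    simp only [liftStmt, stepAux]
    rw [← ih, ← liftStk_update]; rfl
  | peek k f q ih => simp only [liftStmt, stepAux]; rw [← ih]; rfl
  | pop k f q ih =>
    simp only [liftStmt, stepAux]
    rw [← ih, ← liftStk_update]; rfl
  | load f q ih => simp only [liftStmt, stepAux]; rw [← ih]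
  | branch f q₁ q₂ ih₁ ih₂ =>
    simp only [liftStmt, stepAux]
    cases f v <;> simp [ih₁, ih₂]
  | goto f => rfl
  | halt => rfl

theorem step_liftCfg (p : tm.Γ tm.k₀ → Bool) (g : tm.Γ tm.k₀) (c : TM2.Cfg tm.Γ tm.Λ tm.σ) :
    TM2.step (prog p g) (liftCfg c) = (TM2.step tm.m c).map liftCfg := by
  obtain ⟨l, v, S⟩ := c
  cases l with
  | none => rfl
  | some l => exact congrArg some (stepAux_liftStmt (tm.m l) v S)

theorem iterate_liftCfg (p : tm.Γ tm.k₀ → Bool) (g : tm.Γ tm.k₀) (n : ℕ)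
    (c : Option (TM2.Cfg tm.Γ tm.Λ tm.σ)) :
    (flip Bind.bind (TM2.step (prog p g)))^[n] (c.map liftCfg) =
      ((flip Bind.bind (TM2.step tm.m))^[n] c).map liftCfg := by
  induction n generalizing c with
  | zero => rfl
  | succ n ih =>
    rw [iterate_succ_apply, iterate_succ_apply, ← ih]
    congr 1
    cases c with
    | none => rfl
    | some c => exact step_liftCfg p g c

/-- The stacks holding only the two given words, on the input and on the additional stack. -/
def twoStk (a b : List (tm.Γ tm.k₀)) : ∀ o, List (Alph tm o) :=
  update (update (fun _ => []) none b) (some tm.k₀) a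

/-- One step per symbol and one more to find the stack empty, which also resets the register. The
transfer reverses the word; the second pass restores its order. -/
theorem iterate_first_pass (p : tm.Γ tm.k₀ → Bool) (g : tm.Γ tm.k₀) (v : tm.σ)
    (a b : List (tm.Γ tm.k₀)) (r : Option (tm.Γ tm.k₀)) :
    (flip Bind.bind (TM2.step (prog p g)))^[a.length + 1]
        (some ⟨some (.inr false), (r, v), twoStk a b⟩) =
      some ⟨some (.inr true), (none, v), twoStk [] ((a.filter p).reverse ++ b)⟩ := by
  induction a generalizing b r with
  | nil =>
    simp [flip, prog, twoStk]
  | cons x a ih =>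
    rw [List.length_cons, iterate_succ_apply]
    have : flip Bind.bind (TM2.step (prog p g)) (some ⟨some (.inr false), (r, v), twoStk (x :: a) b⟩) =
        some ⟨some (.inr false), (some x, v), twoStk a (if p x then x :: b else b)⟩ := by
      by_cases hp : p x
      · simp [flip, prog, twoStk, hp]
        rw [update_comm (by simp)]
        simp
      · simp [flip, prog, twoStk, hp]
    rw [this, ih]
    by_cases hp : p x <;> simp [hp]

theorem iterate_second_pass (p : tm.Γ tm.k₀ → Bool) (g : tm.Γ tm.k₀) (v : tm.σ)
    (a b : List (tm.Γ tm.k₀)) (r : Option (tm.Γ tm.k₀)) :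
    (flip Bind.bind (TM2.step (prog p g)))^[b.length + 1]
        (some ⟨some (.inr true), (r, v), twoStk a b⟩) =
      some ⟨some (.inl tm.main), (none, v), twoStk (b.reverse ++ a) []⟩ := by
  induction b generalizing a r with
  | nil =>
    simp [flip, prog, twoStk]
  | cons x b ih =>
    rw [List.length_cons, iterate_succ_apply]
    have : flip Bind.bind (TM2.step (prog p g)) (some ⟨some (.inr true), (r, v), twoStk a (x :: b)⟩) =
        some ⟨some (.inr true), (some x, v), twoStk (x :: a) b⟩ := by
      simp [flip, prog, twoStk]
      rw [update_comm (by simp)]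
      simp
      rw [update_comm (by simp)]
      simp
    rw [this, ih]
    simp

/-- Replaces the dependent conditional with a cast in `initList` and `haltList` by `update`, for
which rewriting lemmas apply. -/
theorem dite_stk_eq_update {K : Type} [DecidableEq K] {Γ : K → Type} (k₀ : K) (s : List (Γ k₀)) :
    (fun k => dite (k = k₀) (fun h => by rw [h]; exact s) fun _ => [] : ∀ k, List (Γ k)) =
      update (fun _ => []) k₀ s := by
  funext k
  by_cases h : k = k₀
  · subst h; simp
  · simp [h]

theorem initList_machine (p : tm.Γ tm.k₀ → Bool) (g : tm.Γ tm.k₀) (a : List (tm.Γ tm.k₀)) :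
    initList (machine tm p g) a =
      (⟨some (.inr false), (none, tm.initialState), twoStk a []⟩ :
        TM2.Cfg (Alph tm) (Label tm) (State tm)) := by
  have := dite_stk_eq_update (Γ := Alph tm) (some tm.k₀) a
  have h2 : (update (fun _ => []) none [] : ∀ o, List (Alph tm o)) = fun _ => [] := by simp
  rw [twoStk, h2, ← this]
  rfl

theorem liftStk_empty_update (k : tm.K) (a : List (tm.Γ k)) :
    liftStk (update (fun _ => []) k a) = update (fun _ => [] : ∀ o, List (Alph tm o)) (some k) a := by
  rw [← liftStk_update]
  congr 1
  funext o
  cases o <;> rfl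

theorem liftCfg_initList (a : List (tm.Γ tm.k₀)) :
    liftCfg (initList tm a) = ⟨some (.inl tm.main), (none, tm.initialState), twoStk a []⟩ := by
  have h1 : liftCfg (initList tm a) =
      ⟨some (.inl tm.main), (none, tm.initialState), liftStk (update (fun _ => []) tm.k₀ a)⟩ :=
    congrArg (fun S => liftCfg ⟨some tm.main, tm.initialState, S⟩) (dite_stk_eq_update tm.k₀ a)
  have h2 : (update (fun _ => []) none [] : ∀ o, List (Alph tm o)) = fun _ => [] := by simp
  rw [h1, twoStk, h2, liftStk_empty_update]

theorem liftCfg_haltList (p : tm.Γ tm.k₀ → Bool) (g : tm.Γ tm.k₀) (a : List (tm.Γ tm.k₁)) :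
    liftCfg (haltList tm a) = haltList (machine tm p g) a := by
  have h1 : (haltList (machine tm p g) a : TM2.Cfg (Alph tm) (Label tm) (State tm)) =
      ⟨none, (none, tm.initialState), update (fun _ => []) (some tm.k₁) a⟩ :=
    congrArg (fun S => (⟨none, (none, tm.initialState), S⟩ :
      TM2.Cfg (Alph tm) (Label tm) (State tm))) (dite_stk_eq_update (Γ := Alph tm) (some tm.k₁) a)
  have h2 : liftCfg (haltList tm a) =
      ⟨none, (none, tm.initialState), liftStk (update (fun _ => []) tm.k₁ a)⟩ :=
    congrArg (fun S => liftCfg ⟨none, tm.initialState, S⟩) (dite_stk_eq_update tm.k₁ a)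
  exact h2.trans (Eq.trans (by rw [liftStk_empty_update]; rfl) h1.symm)

/-- Running the extended machine amounts to filtering the input and running the original one. -/
theorem evals_machine (p : tm.Γ tm.k₀ → Bool) (g : tm.Γ tm.k₀) (a : List (tm.Γ tm.k₀))
    (b : List (tm.Γ tm.k₁)) (m : ℕ) (h : TM2OutputsInTime tm (a.filter p) (some b) m) :
    Nonempty (TM2OutputsInTime (machine tm p g) a (some b) (m + 2 * a.length + 2)) := by
  obtain ⟨⟨N, hN⟩, hle⟩ := h
  -- Iterates act from the right: the last summand is the first pass, the middle one the second
  -- pass, and `N` the original run.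
  refine ⟨⟨⟨N + ((a.filter p).length + 1 + (a.length + 1)), ?_⟩, ?_⟩⟩
  · rw [iterate_add_apply, iterate_add_apply]
    have e1 := iterate_first_pass p g tm.initialState a [] none
    have e2 := iterate_second_pass p g tm.initialState [] ((a.filter p).reverse ++ []) none
    rw [List.append_nil, List.length_reverse, List.reverse_reverse, List.append_nil] at e2
    rw [List.append_nil] at e1
    have e3 := iterate_liftCfg p g N (some (initList tm (a.filter p)))
    have e4 : Option.map liftCfg (some (initList tm (a.filter p))) =
        some ⟨some (.inl tm.main), (none, tm.initialState), twoStk (a.filter p) []⟩ :=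
      congrArg some (liftCfg_initList _)
    rw [e4] at e3
    have e5 : Option.map liftCfg ((flip Bind.bind (TM2.step tm.m))^[N]
        (some (initList tm (a.filter p)))) = some (haltList (machine tm p g) b) := by
      refine (congrArg (Option.map liftCfg) hN).trans ?_
      exact congrArg some (liftCfg_haltList p g b)
    refine Eq.trans ?_ (e3.trans e5)
    congr 1
    refine Eq.trans ?_ e2
    congr 1
    refine Eq.trans ?_ e1
    congr 1
    exact congrArg some (initList_machine p g a)
  · have := List.length_filter_le p a
    lia

end FilterTM

/-- Precomposition with a map that amounts to deleting symbols of the encoding preserves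
polynomial-time computability. -/
theorem TM2ComputableInPolyTime.of_filter {α α' β Γ₀ Γ₁ : Type} [Inhabited Γ₀]
    {ea : α → List Γ₀} {ea' : α' → List Γ₀} {eb : β → List Γ₁} {f : α → β} (p : Γ₀ → Bool)
    (r : α' → α) (hr : ∀ a, ea (r a) = (ea' a).filter p)
    (h : Turing.TM2ComputableInPolyTime ea eb f) :
    Nonempty (Turing.TM2ComputableInPolyTime ea' eb (f ∘ r)) := by
  let q : h.tm.Γ h.tm.k₀ → Bool := fun x => p (h.inputAlphabet x)
  -- The symbol passed to the machine is only the fallback of `getD`; it is never used, because the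
  -- program tests `isSome` first.
  have key : ∀ a, Nonempty (Turing.TM2OutputsInTime
      (FilterTM.machine h.tm q (h.inputAlphabet.symm default))
      (List.map h.inputAlphabet.invFun (ea' a))
      (some (List.map h.outputAlphabet.invFun (eb (f (r a)))))
      ((h.time + 2 * Polynomial.X + 2).eval (ea' a).length)) := by
    intro a
    have h1 := h.outputsFun (r a)
    have h2 : List.map h.inputAlphabet.invFun (ea (r a)) =
        (List.map h.inputAlphabet.invFun (ea' a)).filter q := by
      rw [hr, List.filter_map]
      congr 2
      funext x
      simp [q]
    rw [h2] at h1
    obtain ⟨h3⟩ := FilterTM.evals_machine q (h.inputAlphabet.symm default) _ _ _ h1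
    refine ⟨⟨h3.toEvalsTo, h3.steps_le_m.trans ?_⟩⟩
    have h4 : (ea (r a)).length ≤ (ea' a).length := by
      rw [hr]; exact List.length_filter_le _ _
    -- A polynomial with natural coefficients is monotone.
    have h5 : h.time.eval (ea (r a)).length ≤ h.time.eval (ea' a).length := by
      rw [Polynomial.eval_eq_sum_range, Polynomial.eval_eq_sum_range]
      gcongr
    simp only [Polynomial.eval_add, Polynomial.eval_mul, Polynomial.eval_X, List.length_map,
      Polynomial.eval_ofNat]
    lia
  exact ⟨{ tm := FilterTM.machine h.tm q (h.inputAlphabet.symm default)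
           inputAlphabet := h.inputAlphabet
           outputAlphabet := h.outputAlphabet
           time := h.time + 2 * Polynomial.X + 2
           outputsFun := fun a => (key a).some }⟩

/-! ### Reading the signs of a table of real numbers -/

/-- The sign of an integer, as a spin. -/
def intSign (m : ℤ) : ℤˣ := if 0 ≤ m then 1 else -1

/-- The sign of a real number, as a spin. -/
noncomputable def realSign (z : ℝ) : ℤˣ := if 0 ≤ z then 1 else -1

/-- Whether a symbol is not a binary digit. -/
def Symb.notDigit : Symb → Bool
  | .digit _ => false
  | _ => true

theorem encodeSpin_intSign (m : ℤ) :
    encodeSpin (intSign m) = (encodeInt m).filter Symb.notDigit := by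
  have h1 : (m.natAbs.bits.map Symb.digit).filter Symb.notDigit = [] := by
    rw [List.filter_eq_nil_iff]
    intro x hx
    obtain ⟨b, -, rfl⟩ := List.mem_map.1 hx
    simp [Symb.notDigit]
  have h2 : decide (intSign m = 1) = decide (0 ≤ m) := by
    by_cases h : 0 ≤ m <;> simp [intSign, h]
  rw [encodeInt, encodeSpin, h2, List.filter_cons_of_pos rfl, h1]

theorem encodeTable_intSign (x : ℕ × List (List ℤ)) :
    encodeTable encodeSpin (x.1, x.2.map (List.map intSign)) =
      (encodeTable encodeInt x).filter Symb.notDigit := by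
  simp only [encodeTable, List.filter_append, List.filter_replicate, List.filter_flatMap,
    List.flatMap_map]
  congr 1
  refine List.flatMap_congr fun row _ => ?_
  rw [List.filter_cons_of_pos rfl, List.filter_flatMap]
  congr 1
  exact List.flatMap_congr fun m _ => encodeSpin_intSign m

/-- Rounding down preserves nonnegativity in both directions, so the sign survives at every
precision. -/
theorem intSign_quantize (t : ℕ) (z : ℝ) : intSign (quantize t z) = realSign z := by
  have : 0 ≤ quantize t z ↔ 0 ≤ z := by
    rw [quantize, Int.floor_nonneg]
    exact mul_nonneg_iff_of_pos_left (by positivity)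
  simp [intSign, realSign, this]

/-- Applying a polynomial-time test for spins to the signs of real data is a polynomial-time test. -/
theorem IsPolyTimeSpinTest.comp_sign {d : ℕ → ℕ} {s : ℕ → ℕ}
    {ψ : ∀ n, (Fin n → Fin (d n) → ℤˣ) → Bool} (h : IsPolyTimeSpinTest s ψ) :
    IsPolyTimeRealTest s fun n (z : Fin n → EuclideanSpace ℝ (Fin (d n))) =>
      ψ n fun i j => realSign (z i j) := by
  obtain ⟨f, ⟨hf⟩, h⟩ := h
  have : Inhabited Symb := ⟨Symb.tick⟩
  -- The zero precision polynomial suffices: the integer part already determines the sign.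
  refine ⟨f ∘ fun x => (x.1, x.2.map (List.map intSign)), 0,
    TM2ComputableInPolyTime.of_filter Symb.notDigit _ encodeTable_intSign hf, fun n z => ?_⟩
  refine (h n _).trans ?_
  rw [Function.comp_apply]
  congr 2
  simp only [tableRows, List.map_ofFn]
  congr 1
  funext i
  simp only [Function.comp_apply, List.map_ofFn]
  congr 1
  funext j
  simp [intSign_quantize]

/-! ### The chi-square bound for product measures on finite spaces -/

/-- The total variation distance is bounded by the chi-square divergence. -/
theorem sq_sum_abs_sub_le {Ω : Type*} [Fintype Ω] {p q : Ω → ℝ} (hq : ∀ x, 0 < q x)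
    (hp1 : ∑ x, p x = 1) (hq1 : ∑ x, q x = 1) :
    (∑ x, |p x - q x|) ^ 2 ≤ ∑ x, p x ^ 2 / q x - 1 := by
  -- Cauchy–Schwarz for `|p - q| = (|p - q| / √q) * √q`.
  have h := Finset.sum_sq_le_sum_mul_sum_of_sq_le_mul Finset.univ
    (r := fun x => |p x - q x|) (f := fun x => (p x - q x) ^ 2 / q x) (g := q)
    (fun x _ => div_nonneg (sq_nonneg _) (hq x).le) (fun x _ => (hq x).le) (fun x _ => by
      rw [sq_abs, div_mul_cancel₀ _ (hq x).ne'])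
  rw [hq1, mul_one] at h
  refine h.trans (le_of_eq ?_)
  have : ∀ x, (p x - q x) ^ 2 / q x = p x ^ 2 / q x - 2 * p x + q x := fun x => by
    have := (hq x).ne'
    field_simp
    ring
  simp only [this, Finset.sum_add_distrib, Finset.sum_sub_distrib, ← Finset.mul_sum, hp1, hq1]
  ring

theorem sum_pi_prod {Ω : Type*} [Fintype Ω] {ι : Type*} [Fintype ι] [DecidableEq ι]
    (f : ι → Ω → ℝ) : ∑ x : ι → Ω, ∏ i, f i (x i) = ∏ i, ∑ u, f i u := by
  rw [Finset.prod_univ_sum, Fintype.piFinset_univ]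

theorem measureReal_eq_sum_ite {Ω : Type*} [Fintype Ω] [MeasurableSpace Ω]
    [MeasurableSingletonClass Ω] (μ : Measure Ω) [IsFiniteMeasure μ] (E : Set Ω)
    [DecidablePred (· ∈ E)] : μ.real E = ∑ x, if x ∈ E then μ.real {x} else 0 := by
  rw [← Finset.sum_filter, sum_measureReal_singleton]
  congr 1
  ext; simp

theorem pi_measureReal_singleton {ι Ω : Type*} [Fintype ι] [MeasurableSpace Ω]
    (μ : Measure Ω) [IsProbabilityMeasure μ] (x : ι → Ω) :
    (Measure.pi fun _ : ι => μ).real {x} = ∏ i, μ.real {x i} := by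
  simp [measureReal_def, Measure.pi_singleton, ENNReal.toReal_prod]

/-- Comparison of product measures by means of the chi-square divergence of the factors. -/
theorem pi_measureReal_le {Ω : Type*} [Fintype Ω] [MeasurableSpace Ω]
    [MeasurableSingletonClass Ω] (μ ν : Measure Ω) [IsProbabilityMeasure μ]
    [IsProbabilityMeasure ν] (hν : ∀ x, 0 < ν.real {x}) {χ : ℝ}
    (h : ∑ x, μ.real {x} ^ 2 / ν.real {x} ≤ 1 + χ) (n : ℕ) (E : Set (Fin n → Ω)) :
    (Measure.pi fun _ : Fin n => μ).real E ≤
      (Measure.pi fun _ : Fin n => ν).real E + √((1 + χ) ^ n - 1) := by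
  classical
  have hsum : ∀ (ρ : Measure Ω) [IsProbabilityMeasure ρ], ∑ x, ρ.real {x} = 1 := fun ρ _ => by
    rw [sum_measureReal_singleton]; simp
  have hpi : ∀ (ρ : Measure Ω) [IsProbabilityMeasure ρ],
      ∑ x : Fin n → Ω, ∏ i, ρ.real {x i} = 1 := fun ρ _ => by
    rw [sum_pi_prod (fun _ u => ρ.real {u})]; simp [hsum]
  have h1 := sq_sum_abs_sub_le (p := fun x : Fin n → Ω => ∏ i, μ.real {x i})
    (q := fun x : Fin n → Ω => ∏ i, ν.real {x i}) (fun x => Finset.prod_pos fun i _ => hν _)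
    (hpi μ) (hpi ν)
  -- One plus the chi-square divergence is multiplicative over independent factors.
  have h2 : ∑ x : Fin n → Ω, (∏ i, μ.real {x i}) ^ 2 / ∏ i, ν.real {x i} ≤ (1 + χ) ^ n := by
    simp only [← Finset.prod_pow, ← Finset.prod_div_distrib]
    rw [sum_pi_prod (fun _ u => μ.real {u} ^ 2 / ν.real {u})]
    rw [Finset.prod_const, Finset.card_univ, Fintype.card_fin]
    exact pow_le_pow_left₀ (Finset.sum_nonneg fun x _ => by have := (hν x).le; positivity) h n
  have h3 : ∑ x : Fin n → Ω, |∏ i, μ.real {x i} - ∏ i, ν.real {x i}| ≤ √((1 + χ) ^ n - 1) :=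
    Real.le_sqrt_of_sq_le (h1.trans (by linarith))
  refine le_trans ?_ (add_le_add_right h3 _)
  rw [measureReal_eq_sum_ite, measureReal_eq_sum_ite, ← Finset.sum_add_distrib]
  refine Finset.sum_le_sum fun x _ => ?_
  rw [pi_measureReal_singleton, pi_measureReal_singleton]
  split_ifs
  · linarith [le_abs_self (∏ i, μ.real {x i} - ∏ i, ν.real {x i})]
  · positivity

/-! ### Pointwise estimates -/

/-- Taylor's remainder `R s` for the `s`-th power satisfies `R (s + 1) = a * R s + s * b ^ (s - 1) *
(a - b) ^ 2`, which gives the bound by induction. -/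
theorem abs_pow_sub_pow_sub_le {a b M : ℝ} (hM : 1 ≤ M) (ha : |a| ≤ M) (hb : |b| ≤ M) (s : ℕ) :
    |a ^ s - b ^ s - s * b ^ (s - 1) * (a - b)| ≤ s ^ 2 * M ^ s * (a - b) ^ 2 := by
  induction s with
  | zero => simp
  | succ s ih =>
    have key : a ^ (s + 1) - b ^ (s + 1) - (s + 1 : ℕ) * b ^ (s + 1 - 1) * (a - b) =
        a * (a ^ s - b ^ s - s * b ^ (s - 1) * (a - b)) + s * b ^ (s - 1) * (a - b) ^ 2 := by
      rcases s with _ | s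
      · simp
      · simp only [Nat.add_sub_cancel]
        push_cast
        ring
    have hM0 : 0 ≤ M := by linarith
    have h1 : |a * (a ^ s - b ^ s - s * b ^ (s - 1) * (a - b))| ≤
        M * (s ^ 2 * M ^ s * (a - b) ^ 2) := by
      rw [abs_mul]; gcongr
    have h2 : |s * b ^ (s - 1) * (a - b) ^ 2| ≤ s * M ^ (s + 1) * (a - b) ^ 2 := by
      rw [abs_mul, abs_mul, abs_pow, abs_of_nonneg (sq_nonneg (a - b)), Nat.abs_cast]
      gcongr
      exact (pow_le_pow_left₀ (abs_nonneg _) hb _).trans (pow_le_pow_right₀ hM (by lia))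
    rw [key]
    refine (abs_add_le _ _).trans ((add_le_add h1 h2).trans ?_)
    push_cast
    have : 0 ≤ (s + 1) * (M ^ (s + 1) * (a - b) ^ 2) := by positivity
    linarith [show ((s : ℝ) + 1) ^ 2 * M ^ (s + 1) * (a - b) ^ 2 =
      M * (s ^ 2 * M ^ s * (a - b) ^ 2) + s * M ^ (s + 1) * (a - b) ^ 2 +
        (s + 1) * (M ^ (s + 1) * (a - b) ^ 2) by ring]

/-- This quantity is the total mass of one tilted spin. The lower bound multiplies `1 - w ^ 2 / 2`
by `1 + w ^ 2 / 2`, and is trivial once the first factor is negative. -/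
theorem exp_mul_cosh_mem (w : ℝ) :
    1 - w ^ 4 / 4 ≤ Real.exp (-(w ^ 2 / 2)) * Real.cosh w ∧
      Real.exp (-(w ^ 2 / 2)) * Real.cosh w ≤ 1 := by
  constructor
  · have h1 := Real.one_sub_le_exp_neg (w ^ 2 / 2)
    have h2 : 1 + w ^ 2 / 2 ≤ Real.cosh w := by
      have h3 : |w / 2| ≤ |Real.sinh (w / 2)| := by
        rw [Real.abs_sinh]; exact Real.self_le_sinh_iff.2 (abs_nonneg _)
      have h4 : Real.cosh w = Real.cosh (w / 2) ^ 2 + Real.sinh (w / 2) ^ 2 := by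
        rw [← Real.cosh_two_mul]; congr 1; ring
      have := sq_le_sq.2 h3
      rw [h4, Real.cosh_sq]
      linarith
    by_cases h : w ^ 2 / 2 ≤ 1
    · calc 1 - w ^ 4 / 4 = (1 - w ^ 2 / 2) * (1 + w ^ 2 / 2) := by ring
        _ ≤ _ := by gcongr
    · have : 0 < Real.exp (-(w ^ 2 / 2)) * Real.cosh w :=
        mul_pos (Real.exp_pos _) (Real.cosh_pos w)
      nlinarith
  · calc _ ≤ Real.exp (-(w ^ 2 / 2)) * Real.exp (w ^ 2 / 2) := by
          gcongr; exact Real.cosh_le_exp_half_sq w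
      _ = 1 := by rw [← Real.exp_add]; simp

theorem sinh_le_mul_exp {w : ℝ} (hw : 0 ≤ w) : Real.sinh w ≤ w * Real.exp (w ^ 2 / 2) := by
  have hd : ∀ x, HasDerivAt (fun x => x * Real.cosh x - Real.sinh x) (x * Real.sinh x) x :=
    fun x => by
      refine (((hasDerivAt_id x).mul (Real.hasDerivAt_cosh x)).sub
        (Real.hasDerivAt_sinh x)).congr_deriv ?_
      simp
  have hmono : MonotoneOn (fun x => x * Real.cosh x - Real.sinh x) (Set.Ici 0) := by
    refine monotoneOn_of_deriv_nonneg (convex_Ici 0)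
      (fun x _ => (hd x).continuousAt.continuousWithinAt)
      (fun x _ => (hd x).differentiableAt.differentiableWithinAt) fun x hx => ?_
    rw [interior_Ici] at hx
    rw [(hd x).deriv]
    exact mul_nonneg (le_of_lt hx) (Real.sinh_nonneg_iff.2 (le_of_lt hx))
  have h := hmono Set.self_mem_Ici hw hw
  simp only [Real.sinh_zero, zero_mul, sub_zero] at h
  have : w * Real.cosh w ≤ w * Real.exp (w ^ 2 / 2) := by
    gcongr; exact Real.cosh_le_exp_half_sq w
  linarith

/-- This is the first moment of one tilted spin. Like the mean sign, it agrees with `w` to third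
order, so the two first moments differ by `O(|w| ^ 3)`. -/
theorem exp_mul_sinh_bounds (w : ℝ) :
    |Real.exp (-(w ^ 2 / 2)) * Real.sinh w| ≤ |w| ∧
      |w - Real.exp (-(w ^ 2 / 2)) * Real.sinh w| ≤ |w| ^ 3 / 2 := by
  wlog hw : 0 ≤ w generalizing w
  · have := this (-w) (by linarith)
    simp only [Real.sinh_neg, neg_sq, abs_neg, mul_neg] at this
    rw [neg_sub_neg, abs_sub_comm] at this
    exact this
  have h0 : 0 ≤ Real.exp (-(w ^ 2 / 2)) * Real.sinh w :=
    mul_nonneg (Real.exp_pos _).le (Real.sinh_nonneg_iff.2 hw)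
  have h1 : Real.exp (-(w ^ 2 / 2)) * Real.sinh w ≤ w := by
    calc _ ≤ Real.exp (-(w ^ 2 / 2)) * (w * Real.exp (w ^ 2 / 2)) := by
          gcongr; exact sinh_le_mul_exp hw
      _ = w * Real.exp (-(w ^ 2 / 2) + w ^ 2 / 2) := by rw [Real.exp_add]; ring
      _ = w := by simp
  have h2 : (1 - w ^ 2 / 2) * w ≤ Real.exp (-(w ^ 2 / 2)) * Real.sinh w := by
    calc _ ≤ Real.exp (-(w ^ 2 / 2)) * w := by
          gcongr; exact Real.one_sub_le_exp_neg _
      _ ≤ _ := by gcongr; exact Real.self_le_sinh_iff.2 hw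
  rw [abs_of_nonneg h0, abs_of_nonneg hw]
  exact ⟨h1, abs_le.2 ⟨by nlinarith [pow_nonneg hw 3], by nlinarith⟩⟩

/-- The `s`-fold product of the second-order expansion. -/
theorem pow_sub_two_pow_add_pow_le {w m : ℝ} (hm : |m| ≤ |w|) (hmw : |m - w| ≤ |w| ^ 3) (s : ℕ)
    {c q : ℝ} (hc : c = Real.exp (-(w ^ 2 / 2)) * Real.cosh w)
    (hq : q = Real.exp (-(w ^ 2 / 2)) * Real.sinh w) :
    (1 + m ^ 2) ^ s - 2 * (c + m * q) ^ s + (c ^ 2 + q ^ 2) ^ s ≤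
      Real.exp (s * w ^ 2) * (3 * s * w ^ 6 + 9 * s ^ 2 * w ^ 8) := by
  obtain ⟨hc1, hc2⟩ := exp_mul_cosh_mem w
  obtain ⟨hq1, hq2⟩ := exp_mul_sinh_bounds w
  have hc0 : 0 < Real.exp (-(w ^ 2 / 2)) * Real.cosh w :=
    mul_pos (Real.exp_pos _) (Real.cosh_pos w)
  rw [← hc] at hc0 hc1 hc2
  rw [← hq] at hq1 hq2
  clear hc hq
  have hmq : |m - q| ≤ 3 / 2 * |w| ^ 3 := by
    calc |m - q| = |(m - w) + (w - q)| := by ring_nf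
      _ ≤ _ := (abs_add_le _ _).trans (by linarith)
  have hmq2 : (m - q) ^ 2 ≤ 9 / 4 * w ^ 6 := by
    calc (m - q) ^ 2 = |m - q| ^ 2 := (sq_abs _).symm
      _ ≤ (3 / 2 * |w| ^ 3) ^ 2 := by gcongr
      _ = 9 / 4 * |w| ^ 6 := by ring
      _ = 9 / 4 * w ^ 6 := by rw [Even.pow_abs (by decide)]
  have h4 : |w| * (3 / 2 * |w| ^ 3) = 3 / 2 * w ^ 4 := by
    rw [← Even.pow_abs (show Even 4 by decide) w]; ring
  have hm2 : m ^ 2 ≤ w ^ 2 := sq_le_sq.2 hm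
  have hq2' : q ^ 2 ≤ w ^ 2 := sq_le_sq.2 hq1
  have hmqw : |m * q| ≤ w ^ 2 := by
    rw [abs_mul, ← sq_abs w, sq]; gcongr
  set M := 1 + w ^ 2 with hM
  have hM1 : 1 ≤ M := by nlinarith
  have hα : |1 + m ^ 2| ≤ M := by rw [abs_of_nonneg (by positivity)]; linarith
  have hβ : |c + m * q| ≤ M :=
    (abs_add_le _ _).trans (by rw [abs_of_pos hc0]; linarith)
  have hγ : |c ^ 2 + q ^ 2| ≤ M := by
    rw [abs_of_nonneg (by positivity)]; nlinarith
  have hαβ : |1 + m ^ 2 - (c + m * q)| ≤ 2 * w ^ 4 := by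
    calc |1 + m ^ 2 - (c + m * q)| = |(1 - c) + m * (m - q)| := by ring_nf
      _ ≤ |1 - c| + |m| * |m - q| := by rw [← abs_mul]; exact abs_add_le _ _
      _ ≤ w ^ 4 / 4 + |w| * (3 / 2 * |w| ^ 3) := by
        gcongr
        rw [abs_of_nonneg (by linarith)]; linarith
      _ ≤ 2 * w ^ 4 := by rw [h4]; nlinarith [sq_nonneg (w ^ 2)]
  have hγβ : |c ^ 2 + q ^ 2 - (c + m * q)| ≤ 2 * w ^ 4 := by
    calc |c ^ 2 + q ^ 2 - (c + m * q)| = |c * (c - 1) + q * (q - m)| := by ring_nf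
      _ ≤ |c| * |1 - c| + |q| * |m - q| := by
        rw [abs_sub_comm 1 c, abs_sub_comm m q, ← abs_mul, ← abs_mul]; exact abs_add_le _ _
      _ ≤ 1 * (w ^ 4 / 4) + |w| * (3 / 2 * |w| ^ 3) := by
        gcongr
        · rw [abs_of_pos hc0]; exact hc2
        · rw [abs_of_nonneg (by linarith)]; linarith
      _ ≤ 2 * w ^ 4 := by rw [h4]; nlinarith [sq_nonneg (w ^ 2)]
  have hsq : ∀ y : ℝ, |y| ≤ 2 * w ^ 4 → y ^ 2 ≤ 4 * w ^ 8 := fun y hy => by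
    rw [← sq_abs]
    calc |y| ^ 2 ≤ (2 * w ^ 4) ^ 2 := by gcongr
      _ = 4 * w ^ 8 := by ring
  -- Expand the two outer powers around the middle base `c + m * q`. The linear terms add up to a
  -- multiple of `(1 - c) ^ 2 + (m - q) ^ 2`, of order `w ^ 6`; the differences of the bases are
  -- `O(w ^ 4)`, so the remainders are `O(s ^ 2 * w ^ 8)`.
  have e1 := (le_abs_self _).trans (abs_pow_sub_pow_sub_le hM1 hα hβ s)
  have e2 := (le_abs_self _).trans (abs_pow_sub_pow_sub_le hM1 hγ hβ s)
  have hM0 : 0 ≤ M := by linarith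
  have e3 : s * (c + m * q) ^ (s - 1) * ((1 - c) ^ 2 + (m - q) ^ 2) ≤
      s * M ^ s * (w ^ 8 / 16 + 9 / 4 * w ^ 6) := by
    have : (1 - c) ^ 2 ≤ w ^ 8 / 16 := by
      calc (1 - c) ^ 2 ≤ (w ^ 4 / 4) ^ 2 := by
            apply pow_le_pow_left₀ <;> linarith
        _ = _ := by ring
    have h5 : (c + m * q) ^ (s - 1) ≤ M ^ s :=
      (le_abs_self _).trans (by
        rw [abs_pow]
        exact (pow_le_pow_left₀ (abs_nonneg _) hβ _).trans (pow_le_pow_right₀ hM1 (by lia)))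
    gcongr
  have e4 : s ^ 2 * M ^ s * (1 + m ^ 2 - (c + m * q)) ^ 2 ≤ s ^ 2 * M ^ s * (4 * w ^ 8) := by
    gcongr; exact hsq _ hαβ
  have e5 : s ^ 2 * M ^ s * (c ^ 2 + q ^ 2 - (c + m * q)) ^ 2 ≤ s ^ 2 * M ^ s * (4 * w ^ 8) := by
    gcongr; exact hsq _ hγβ
  have e6 : M ^ s ≤ Real.exp (s * w ^ 2) := by
    rw [Real.exp_nat_mul]
    gcongr
    rw [hM, add_comm]; exact Real.add_one_le_exp _
  have hs2 : (s : ℝ) ≤ s ^ 2 := by exact_mod_cast Nat.le_self_pow (by decide) s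
  calc _ ≤ s * M ^ s * (w ^ 8 / 16 + 9 / 4 * w ^ 6) + s ^ 2 * M ^ s * (4 * w ^ 8) +
        s ^ 2 * M ^ s * (4 * w ^ 8) := by linear_combination e1 + e2 + e3 + e4 + e5
    _ = M ^ s * (9 / 4 * s * w ^ 6 + (s / 16 + 8 * s ^ 2) * w ^ 8) := by ring
    _ ≤ _ := by
      gcongr
      · norm_num
      · linarith

/-! ### The mean sign of a shifted Gaussian variable -/

/-- The mean of the sign of `y + u`, for `y` standard Gaussian. -/
noncomputable def signMean (u : ℝ) : ℝ := 2 * (gaussianReal 0 1).real (Set.Ici (-u)) - 1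

theorem gaussianReal_real_realSign (u : ℝ) (x : ℤˣ) :
    (gaussianReal 0 1).real {y | realSign (y + u) = x} = (1 + ((x : ℤ) : ℝ) * signMean u) / 2 := by
  have h1 : {y : ℝ | realSign (y + u) = 1} = Set.Ici (-u) := by
    ext y
    have : realSign (y + u) = 1 ↔ 0 ≤ y + u := by
      by_cases h : 0 ≤ y + u <;> simp [realSign, h]
    rw [Set.mem_ofPred_eq, this, Set.mem_Ici, neg_le_iff_add_nonneg]
  rcases Int.units_eq_one_or x with rfl | rfl
  · rw [h1, signMean]
    push_cast
    ring
  · have h2 : {y : ℝ | realSign (y + u) = -1} = (Set.Ici (-u))ᶜ := by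
      rw [← h1]
      ext y
      rcases Int.units_eq_one_or (realSign (y + u)) with h | h <;> simp [h]
    rw [h2, probReal_compl_eq_one_sub measurableSet_Ici, signMean]
    push_cast
    ring

/-- By symmetry and the absence of atoms, each half-line has mass one half. -/
theorem signMean_zero : signMean 0 = 0 := by
  have h1 : (gaussianReal 0 1).real (Set.Iic 0) = (gaussianReal 0 1).real (Set.Ici 0) := by
    have := gaussianReal_map_neg (μ := 0) (v := 1)
    rw [neg_zero] at this
    conv_lhs => rw [← this]
    rw [map_measureReal_apply (by fun_prop) measurableSet_Iic]
    congr 1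
    ext; simp
  have h2 : (gaussianReal 0 1).real (Set.Iic 0) = (gaussianReal 0 1).real (Set.Iio 0) := by
    have := nullSingletonClass_gaussianReal (μ := 0) (v := 1) one_ne_zero
    exact measureReal_congr Iio_ae_eq_Iic.symm
  have h3 := probReal_compl_eq_one_sub (μ := gaussianReal 0 1) (measurableSet_Ici (a := (0 : ℝ)))
  rw [Set.compl_Ici, ← h2, h1] at h3
  rw [signMean, neg_zero]
  linarith

theorem measurable_signMean : Measurable signMean := by
  refine Monotone.measurable fun a b hab => ?_
  rw [signMean, signMean]
  gcongr
  · exact measure_ne_top _ _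

theorem abs_signMean_le_one (u : ℝ) : |signMean u| ≤ 1 := by
  have h1 : (gaussianReal 0 1).real (Set.Ici (-u)) ≤ 1 := measureReal_le_one
  have h2 : 0 ≤ (gaussianReal 0 1).real (Set.Ici (-u)) := measureReal_nonneg
  rw [signMean, abs_le]
  constructor <;> linarith

theorem signMean_eq_integral (u : ℝ) :
    signMean u = √(2 / Real.pi) * ∫ t in (-u)..0, Real.exp (-(t ^ 2 / 2)) := by
  have hr : ∀ a : ℝ, (gaussianReal 0 1).real (Set.Ici a) =
      ∫ t in Set.Ioi a, gaussianPDFReal 0 1 t := fun a => by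
    rw [measureReal_def, gaussianReal_apply_eq_integral 0 one_ne_zero, ENNReal.toReal_ofReal,
      integral_Ici_eq_integral_Ioi]
    exact setIntegral_nonneg measurableSet_Ici fun x _ => gaussianPDFReal_nonneg _ _ _
  have h0 : signMean u - signMean 0 = 2 * ∫ t in (-u)..0, gaussianPDFReal 0 1 t := by
    rw [← intervalIntegral.integral_Ioi_sub_Ioi'
      (integrable_gaussianPDFReal 0 1).integrableOn (integrable_gaussianPDFReal 0 1).integrableOn,
      ← hr, ← hr, signMean, signMean, neg_zero]
    ring
  rw [signMean_zero, sub_zero] at h0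
  rw [h0]
  simp only [gaussianPDFReal, intervalIntegral.integral_const_mul]
  rw [← mul_assoc]
  congr 1
  · rw [NNReal.coe_one, mul_one, Real.sqrt_div' _ Real.pi_pos.le, Real.sqrt_mul' _ Real.pi_pos.le]
    have := Real.sqrt_pos.2 Real.pi_pos
    have h2 : (0 : ℝ) < √2 := by positivity
    field_simp
    simp
  · simp [neg_div]

/-- First-order expansion of the mean sign. -/
theorem signMean_bounds (u : ℝ) :
    |signMean u| ≤ |√(2 / Real.pi) * u| ∧
      |signMean u - √(2 / Real.pi) * u| ≤ |√(2 / Real.pi) * u| ^ 3 := by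
  have hc : 0 ≤ √(2 / Real.pi) := Real.sqrt_nonneg _
  have hint : ∀ a b : ℝ, IntervalIntegrable (fun t : ℝ => Real.exp (-(t ^ 2 / 2))) volume a b :=
    fun a b => Continuous.intervalIntegrable (by fun_prop) a b
  rw [signMean_eq_integral]
  constructor
  · rw [abs_mul, abs_mul]
    refine mul_le_mul_of_nonneg_left ?_ (abs_nonneg _)
    have := intervalIntegral.norm_integral_le_of_norm_le_const (C := 1) (a := -u) (b := 0)
      (f := fun t : ℝ => Real.exp (-(t ^ 2 / 2))) fun t _ => by
        rw [Real.norm_eq_abs, Real.abs_exp, Real.exp_le_one_iff]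
        have := sq_nonneg t; linarith
    simpa using this
  · have h1 : (∫ t in (-u)..0, Real.exp (-(t ^ 2 / 2))) - u =
        ∫ t in (-u)..0, (Real.exp (-(t ^ 2 / 2)) - 1) := by
      rw [intervalIntegral.integral_sub (hint _ _) (by simp)]
      simp
    have h2 : |∫ t in (-u)..0, (Real.exp (-(t ^ 2 / 2)) - 1)| ≤ u ^ 2 / 2 * |u| := by
      have := intervalIntegral.norm_integral_le_of_norm_le_const (C := u ^ 2 / 2) (a := -u)
        (b := 0) (f := fun t : ℝ => Real.exp (-(t ^ 2 / 2)) - 1) fun t ht => by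
          have ht2 : t ^ 2 ≤ u ^ 2 := by
            rw [sq_le_sq]
            rcases Set.mem_uIoc.1 ht with h | h
            · rw [abs_of_nonpos h.2]; exact (by linarith [h.1] : -t ≤ u).trans (le_abs_self u)
            · rw [abs_of_pos h.1]; exact h.2.trans (neg_le_abs u)
          have e1 := Real.one_sub_le_exp_neg (t ^ 2 / 2)
          have e2 : Real.exp (-(t ^ 2 / 2)) ≤ 1 := by
            rw [Real.exp_le_one_iff]; have := sq_nonneg t; linarith
          rw [Real.norm_eq_abs, abs_le]
          constructor <;> linarith [sq_nonneg u]
      simpa using this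
    rw [← mul_sub, h1, abs_mul, abs_of_nonneg hc]
    have h3 : |√(2 / Real.pi) * u| ^ 3 = √(2 / Real.pi) * (2 / Real.pi * (u ^ 2 * |u|)) := by
      rw [abs_mul, abs_of_nonneg hc, mul_pow, pow_succ (√(2 / Real.pi)), Real.sq_sqrt (by positivity),
        ← sq_abs u]
      ring
    rw [h3]
    gcongr
    -- The `1 / 2` from `1 - exp (-(t ^ 2 / 2)) ≤ u ^ 2 / 2` is absorbed by the `2 / π` that cubing
    -- the scaled variable produces.
    have h4 : 1 / 2 ≤ 2 / Real.pi := by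
      rw [div_le_div_iff₀ (by norm_num) Real.pi_pos]; linarith [Real.pi_le_four]
    calc _ ≤ u ^ 2 / 2 * |u| := h2
      _ = 1 / 2 * (u ^ 2 * |u|) := by ring
      _ ≤ _ := by gcongr

/-! ### Gaussian integrals -/

/-- Completing the square. With `X` the sum of `s` spins, averaging a linear field over a Gaussian
amplitude creates the pairwise interaction of the clique. -/
theorem integral_exp_gaussianReal {τ : ℝ} (hτ : 0 ≤ τ) (s : ℕ) (X : ℝ) :
    ∫ g, Real.exp (X * (√τ * g) - s * ((√τ * g) ^ 2 / 2)) ∂gaussianReal 0 1 =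
      (√(1 + s * τ))⁻¹ * Real.exp (τ / (2 * (1 + s * τ)) * X ^ 2) := by
  have hb : 0 < 1 + s * τ := by positivity
  rw [integral_gaussianReal_eq_integral_smul one_ne_zero]
  have h : ∀ g : ℝ, gaussianPDFReal 0 1 g •
      Real.exp (X * (√τ * g) - s * ((√τ * g) ^ 2 / 2)) =
      (√(2 * Real.pi))⁻¹ * Real.exp (τ / (2 * (1 + s * τ)) * X ^ 2) *
        Real.exp (-((1 + s * τ) / 2) * (g - X * √τ / (1 + s * τ)) ^ 2) := fun g => by
    rw [gaussianPDFReal, smul_eq_mul, mul_assoc (√(2 * Real.pi * (1 : NNReal)))⁻¹, mul_assoc (√(2 * Real.pi))⁻¹,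
      ← Real.exp_add, ← Real.exp_add]
    simp only [NNReal.coe_one, mul_one, sub_zero]
    congr 2
    obtain ⟨r, hr⟩ : ∃ r, r = √τ := ⟨_, rfl⟩
    have hr2 : τ = r ^ 2 := by rw [hr, Real.sq_sqrt hτ]
    rw [← hr, hr2]
    rw [hr2] at hb
    have := hb.ne'
    field_simp
    ring
  simp only [h]
  rw [integral_const_mul, integral_sub_right_eq_self
    (fun g : ℝ => Real.exp (-((1 + s * τ) / 2) * g ^ 2)), integral_gaussian]
  have : Real.pi / ((1 + s * τ) / 2) = 2 * Real.pi / (1 + s * τ) := by field_simp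
  rw [this, Real.sqrt_div' _ hb.le]
  have h2 : 0 < √(2 * Real.pi) := by positivity
  have h3 : 0 < √(1 + s * τ) := by positivity
  field_simp

/-- Against the Gaussian density, `exp (g ^ 2 / 4)` still leaves decay `exp (-g ^ 2 / 4)`. This
factor will dominate `exp (s * τ * g ^ 2)`. -/
theorem integrable_exp_mul_pow_gaussianReal (k : ℕ) :
    Integrable (fun g : ℝ => Real.exp (g ^ 2 / 4) * g ^ k) (gaussianReal 0 1) := by
  rw [gaussianReal_of_var_ne_zero 0 one_ne_zero,
    integrable_withDensity_iff_integrable_smul' (measurable_gaussianPDF 0 1)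
      (ae_of_all _ fun _ => gaussianPDF_lt_top)]
  have h := (integrable_rpow_mul_exp_neg_mul_sq (b := 1 / 4) (by norm_num) (s := k)
    (by have : (0 : ℝ) ≤ k := by positivity
        linarith)).const_mul (√(2 * Real.pi))⁻¹
  refine h.congr (ae_of_all _ fun g => ?_)
  simp only [toReal_gaussianPDF, gaussianPDFReal, smul_eq_mul, Real.rpow_natCast, NNReal.coe_one,
    mul_one, sub_zero]
  rw [show -(1 / 4 : ℝ) * g ^ 2 = -g ^ 2 / 2 + g ^ 2 / 4 by ring, Real.exp_add]
  ring

/-! ### Spiked Gaussian vectors and the law of their signs -/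

instance measurableSingletonClass_intUnits : MeasurableSingletonClass ℤˣ :=
  ⟨fun u => ⟨{(u : ℤ)}, measurableSet_singleton _, by ext; simp [Units.ext_iff]⟩⟩

theorem measurable_realSign : Measurable realSign :=
  Measurable.ite measurableSet_Ici measurable_const measurable_const

/-- The coordinatewise sign of a vector. -/
noncomputable def signVec {d : ℕ} (z : EuclideanSpace ℝ (Fin d)) : Fin d → ℤˣ :=
  fun j => realSign (z j)

theorem measurable_signVec {d : ℕ} : Measurable (signVec (d := d)) :=
  measurable_pi_lambda _ fun _ => measurable_realSign.comp (by fun_prop)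

theorem posSemidef_spiked {d : ℕ} (v : Fin d → ℝ) (r : ℝ) :
    (1 + r ^ 2 • Matrix.vecMulVec v v : Matrix (Fin d) (Fin d) ℝ).PosSemidef := by
  refine Matrix.PosSemidef.add Matrix.PosSemidef.one ?_
  have : r ^ 2 • Matrix.vecMulVec v v = Matrix.vecMulVec (r • v) (star (r • v)) := by
    ext i j
    simp [Matrix.vecMulVec_apply]
    ring
  rw [this]
  exact Matrix.posSemidef_vecMulVec_self_star _

/-- A Gaussian vector with spiked covariance, as a sum of independent components. -/
theorem multivariateGaussian_spiked {d : ℕ} (v : Fin d → ℝ) (r : ℝ) :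
    multivariateGaussian 0 (1 + r ^ 2 • Matrix.vecMulVec v v) =
      ((stdGaussian (EuclideanSpace ℝ (Fin d))).prod (gaussianReal 0 1)).map
        fun p => p.1 + p.2 • WithLp.toLp 2 (r • v) := by
  have hmeas : Measurable fun p : EuclideanSpace ℝ (Fin d) × ℝ =>
      p.1 + p.2 • WithLp.toLp 2 (r • v) := by fun_prop
  have := Measure.isProbabilityMeasure_map
    (μ := (stdGaussian (EuclideanSpace ℝ (Fin d))).prod (gaussianReal 0 1)) hmeas.aemeasurable
  refine Measure.ext_of_charFun ?_
  funext t
  rw [charFun_multivariateGaussian (posSemidef_spiked v r), charFun_apply,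
    integral_map hmeas.aemeasurable (by fun_prop)]
  have h1 : ∀ p : EuclideanSpace ℝ (Fin d) × ℝ,
      Complex.exp (((inner ℝ (p.1 + p.2 • WithLp.toLp 2 (r • v)) t : ℝ) : ℂ) * Complex.I) =
        Complex.exp ((inner ℝ p.1 t : ℝ) * Complex.I) *
          Complex.exp ((inner ℝ p.2 (inner ℝ (WithLp.toLp 2 (r • v)) t : ℝ) : ℝ) * Complex.I) :=
    fun p => by
      rw [← Complex.exp_add, inner_add_left, real_inner_smul_left]
      congr 1
      simp only [RCLike.inner_apply, conj_trivial]
      push_cast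
      ring
  simp only [h1]
  rw [integral_prod_mul (fun w : EuclideanSpace ℝ (Fin d) =>
      Complex.exp ((inner ℝ w t : ℝ) * Complex.I))
    (fun g : ℝ =>
      Complex.exp ((inner ℝ g (inner ℝ (WithLp.toLp 2 (r • v)) t : ℝ) : ℝ) * Complex.I)), ← charFun_apply, ← charFun_apply, charFun_stdGaussian,
    charFun_gaussianReal, ← Complex.exp_add]
  congr 1
  have h2 : (t.ofLp ⬝ᵥ (1 + r ^ 2 • Matrix.vecMulVec v v) *ᵥ t.ofLp : ℝ) =
      ‖t‖ ^ 2 + (inner ℝ (WithLp.toLp 2 (r • v)) t) ^ 2 := by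
    rw [Matrix.add_mulVec, Matrix.one_mulVec, dotProduct_add, Matrix.smul_mulVec,
      Matrix.vecMulVec_mulVec, EuclideanSpace.inner_eq_star_dotProduct,
      EuclideanSpace.real_norm_sq_eq]
    have h3 : v ⬝ᵥ t.ofLp = t.ofLp ⬝ᵥ v := dotProduct_comm _ _
    have h4 : t.ofLp ⬝ᵥ t.ofLp = ∑ i, t.ofLp i ^ 2 := by simp [dotProduct, sq]
    simp [dotProduct_smul, h3, h4]
    ring
  rw [h2]
  simp
  ring

/-- The law of the signs of a Gaussian vector with spiked covariance. -/
theorem map_signVec_spiked {d : ℕ} (v : Fin d → ℝ) (r : ℝ) (x : Fin d → ℤˣ) :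
    ((multivariateGaussian 0 (1 + r ^ 2 • Matrix.vecMulVec v v)).map signVec).real {x} =
      ∫ g, ∏ i, (1 + ((x i : ℤ) : ℝ) * signMean (r * g * v i)) / 2 ∂gaussianReal 0 1 := by
  have hmeas : Measurable fun p : EuclideanSpace ℝ (Fin d) × ℝ =>
      p.1 + p.2 • WithLp.toLp 2 (r • v) := by fun_prop
  -- For fixed `g` the coordinates are independent shifted Gaussians, and a sign pattern is a box.
  have hF : ∀ g : ℝ, (Measure.pi fun _ : Fin d => gaussianReal 0 1)
      {y | signVec (WithLp.toLp 2 y + g • WithLp.toLp 2 (r • v)) = x} =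
        ENNReal.ofReal (∏ i, (1 + ((x i : ℤ) : ℝ) * signMean (r * g * v i)) / 2) := fun g => by
    have h1 : {y : Fin d → ℝ | signVec (WithLp.toLp 2 y + g • WithLp.toLp 2 (r • v)) = x} =
        Set.univ.pi fun i => {y : ℝ | realSign (y + r * g * v i) = x i} := by
      ext y
      simp only [Set.mem_ofPred_eq, Set.mem_univ_pi, funext_iff, signVec]
      refine forall_congr' fun i => ?_
      simp [mul_assoc, mul_left_comm]
    rw [h1, Measure.pi_pi, ENNReal.ofReal_prod_of_nonneg]
    · refine Finset.prod_congr rfl fun i _ => ?_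
      rw [← gaussianReal_real_realSign, ofReal_measureReal]
    · intro i _
      rw [← gaussianReal_real_realSign]
      exact measureReal_nonneg
  have hset : MeasurableSet ((fun p : EuclideanSpace ℝ (Fin d) × ℝ =>
      p.1 + p.2 • WithLp.toLp 2 (r • v)) ⁻¹' (signVec ⁻¹' {x})) :=
    hmeas (measurable_signVec (measurableSet_singleton x))
  rw [map_measureReal_apply measurable_signVec (measurableSet_singleton x),
    multivariateGaussian_spiked, map_measureReal_apply hmeas
    (measurable_signVec (measurableSet_singleton x)), measureReal_def,
    Measure.prod_apply_symm hset]
  have hG : ∀ g : ℝ, stdGaussian (EuclideanSpace ℝ (Fin d)) ((fun w => (w, g)) ⁻¹'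
      ((fun p : EuclideanSpace ℝ (Fin d) × ℝ => p.1 + p.2 • WithLp.toLp 2 (r • v)) ⁻¹'
        (signVec ⁻¹' {x}))) =
        ENNReal.ofReal (∏ i, (1 + ((x i : ℤ) : ℝ) * signMean (r * g * v i)) / 2) := fun g => by
    rw [← hF, ← map_pi_eq_stdGaussian, Measure.map_apply (by fun_prop)
      (measurable_prodMk_right hset)]
    rfl
  simp only [hG]
  rw [integral_eq_lintegral_of_nonneg_ae]
  · refine ae_of_all _ fun g => Finset.prod_nonneg fun i _ => ?_
    rw [← gaussianReal_real_realSign]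
    exact measureReal_nonneg
  · have := measurable_signMean
    exact Measurable.aestronglyMeasurable (by fun_prop)

/-! ### The Ising model on a clique -/

theorem isingWeight_pos {d : ℕ} (Θ : Matrix (Fin d) (Fin d) ℝ) (x : Fin d → ℤˣ) :
    0 < isingWeight Θ x := Real.exp_pos _

theorem partitionFunction_pos {d : ℕ} (Θ : Matrix (Fin d) (Fin d) ℝ) :
    0 < partitionFunction Θ :=
  Finset.sum_pos (fun x _ => isingWeight_pos Θ x) Finset.univ_nonempty

theorem isingMeasure_singleton {d : ℕ} (Θ : Matrix (Fin d) (Fin d) ℝ) (x : Fin d → ℤˣ) :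
    isingMeasure Θ {x} = ENNReal.ofReal (isingWeight Θ x / partitionFunction Θ) := by
  rw [isingMeasure, Measure.finsetSum_apply, Finset.sum_eq_single x]
  · simp
  · intro y _ hy
    simp [Set.indicator, hy]
  · simp

instance isProbabilityMeasure_isingMeasure {d : ℕ} (Θ : Matrix (Fin d) (Fin d) ℝ) :
    IsProbabilityMeasure (isingMeasure Θ) := by
  constructor
  have h : ∀ x, 0 ≤ isingWeight Θ x / partitionFunction Θ := fun x =>
    div_nonneg (isingWeight_pos Θ x).le (partitionFunction_pos Θ).le
  simp only [isingMeasure, Measure.finsetSum_apply, Measure.smul_apply, measure_univ, smul_eq_mul,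
    mul_one]
  rw [← ENNReal.ofReal_sum_of_nonneg fun x _ => h x, ← Finset.sum_div]
  change ENNReal.ofReal (partitionFunction Θ / partitionFunction Θ) = 1
  rw [div_self (partitionFunction_pos Θ).ne', ENNReal.ofReal_one]

theorem isingMeasure_real_singleton {d : ℕ} (Θ : Matrix (Fin d) (Fin d) ℝ) (x : Fin d → ℤˣ) :
    (isingMeasure Θ).real {x} = isingWeight Θ x / partitionFunction Θ := by
  rw [measureReal_def, isingMeasure_singleton, ENNReal.toReal_ofReal]
  exact div_nonneg (isingWeight_pos Θ x).le (partitionFunction_pos Θ).le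

/-- The interaction matrix of a clique with constant interaction `θ`. -/
def cliqueMatrix {d : ℕ} (I : Finset (Fin d)) (θ : ℝ) : Matrix (Fin d) (Fin d) ℝ :=
  Matrix.of fun i j => if i ≠ j ∧ i ∈ I ∧ j ∈ I then θ else 0

theorem cliqueMatrix_empty {d : ℕ} (θ : ℝ) : cliqueMatrix (∅ : Finset (Fin d)) θ = 0 := by
  ext; simp [cliqueMatrix]

/-- Squared spins are `1`, so adding the diagonal to complete the square costs a constant, which
normalization cancels. -/
theorem isingWeight_cliqueMatrix {d : ℕ} (I : Finset (Fin d)) (θ : ℝ) (x : Fin d → ℤˣ) :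
    isingWeight (cliqueMatrix I θ) x =
      Real.exp (θ * (∑ i ∈ I, ((x i : ℤ) : ℝ)) ^ 2 - θ * I.card) := by
  rw [isingWeight]
  congr 1
  have hx : ∀ i, ((x i : ℤ) : ℝ) * ((x i : ℤ) : ℝ) = 1 := fun i => by
    rcases Int.units_eq_one_or (x i) with h | h <;> simp [h]
  have h1 : ∀ i j, cliqueMatrix I θ i j * ((x i : ℤ) : ℝ) * ((x j : ℤ) : ℝ) =
      θ * ((if i ∈ I then ((x i : ℤ) : ℝ) else 0) * (if j ∈ I then ((x j : ℤ) : ℝ) else 0)) -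
        (if i = j then (if i ∈ I then θ else 0) else 0) := fun i j => by
    by_cases hij : i = j
    · subst hij
      by_cases hi : i ∈ I <;> simp [cliqueMatrix, hi, hx]
    · by_cases hi : i ∈ I <;> by_cases hj : j ∈ I <;> simp [cliqueMatrix, hi, hj, hij, mul_assoc]
  simp only [h1, Finset.sum_sub_distrib, ← Finset.mul_sum, ← Finset.sum_mul]
  simp [Finset.sum_ite_mem, sq, mul_comm]

theorem interactionGraph_cliqueMatrix_adj {d : ℕ} (I : Finset (Fin d)) {θ : ℝ} (hθ : θ ≠ 0)
    (i j : Fin d) :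
    (interactionGraph (cliqueMatrix I θ)).Adj i j ↔ i ≠ j ∧ i ∈ I ∧ j ∈ I := by
  simp only [interactionGraph, SimpleGraph.fromRel_adj, cliqueMatrix, Matrix.of_apply]
  constructor
  · rintro ⟨h, h1 | h1⟩ <;> simp_all
  · rintro ⟨h1, h2, h3⟩
    exact ⟨h1, Or.inl (by simp [h1, h2, h3, hθ])⟩

theorem cliqueMatrix_mem_parameterSpace {d : ℕ} (I : Finset (Fin d)) {θ : ℝ} (hθ : 0 < θ)
    (h : θ * I.card ≤ 1 / 2) :
    cliqueMatrix I θ ∈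
      parameterSpace (graphsContaining (⊤ : SimpleGraph (Fin I.card)) d) θ := by
  refine ⟨?_, ?_, ?_, ?_, ?_⟩
  · ext i j
    simp only [Matrix.transpose_apply, cliqueMatrix, Matrix.of_apply]
    congr 1
    simp only [ne_comm, and_comm]
  · intro i
    simp [cliqueMatrix]
  · refine ⟨⟨⟨fun k => I.equivFin.symm k, fun {a b} hab => ?_⟩, ?_⟩⟩
    · rw [interactionGraph_cliqueMatrix_adj I hθ.ne']
      refine ⟨fun h => ?_, Finset.coe_mem _, Finset.coe_mem _⟩
      exact (SimpleGraph.top_adj _ _).1 hab (I.equivFin.symm.injective (Subtype.ext h))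
    · exact Subtype.val_injective.comp I.equivFin.symm.injective
  · refine (Real.sqrt_le_sqrt (y := (θ * I.card) ^ 2) ?_).trans
      (by rw [Real.sqrt_sq (by positivity)]; exact h)
    have h1 : ∀ i j, cliqueMatrix I θ i j ^ 2 ≤
        θ ^ 2 * ((if i ∈ I then 1 else 0) * (if j ∈ I then 1 else 0)) := fun i j => by
      by_cases hi : i ∈ I <;> by_cases hj : j ∈ I <;> by_cases hij : i = j <;>
        simp [cliqueMatrix, hi, hj, hij, sq_nonneg]
    calc _ ≤ ∑ i, ∑ j, θ ^ 2 * ((if i ∈ I then (1 : ℝ) else 0) * (if j ∈ I then 1 else 0)) :=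
          Finset.sum_le_sum fun i _ => Finset.sum_le_sum fun j _ => h1 i j
      _ = _ := by
        simp only [← Finset.mul_sum, ← Finset.sum_mul]
        simp
        ring
  · intro i j hij
    rw [interactionGraph_cliqueMatrix_adj I hθ.ne'] at hij
    simp [cliqueMatrix, hij]

/-! ### Comparison of a rounded Gaussian vector with the Ising model -/

/-- The chi-square divergence from a normalized sub-probability, in terms of the latter. -/
theorem sum_sq_div_normalized_le {Ω : Type*} [Fintype Ω] {P F : Ω → ℝ} (hP : ∑ x, P x = 1)
    (hF : ∀ x, 0 < F x) (hF1 : ∑ x, F x ≤ 1) :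
    ∑ x, P x ^ 2 / (F x / ∑ y, F y) ≤ 1 + ∑ x, (P x - F x) ^ 2 / F x := by
  set q := ∑ y, F y with hq
  have hq0 : 0 ≤ q := Finset.sum_nonneg fun x _ => (hF x).le
  have h1 : ∀ x, P x ^ 2 / (F x / q) = q * ((P x - F x) ^ 2 / F x + 2 * P x - F x) := fun x => by
    have := (hF x).ne'
    rw [div_div_eq_mul_div]
    field_simp
    ring
  simp only [h1, ← Finset.mul_sum, Finset.sum_sub_distrib, Finset.sum_add_distrib, hP]
  rw [← hq]
  have hA : 0 ≤ ∑ x, (P x - F x) ^ 2 / F x :=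
    Finset.sum_nonneg fun x _ => div_nonneg (sq_nonneg _) (hF x).le
  -- With `A` the sum on the right, the left side is `q * (A + 2 - q)`; here `q * A ≤ A` and `q * (2
  -- - q) ≤ 1`.
  nlinarith [mul_le_mul_of_nonneg_right hF1 hA, sq_nonneg (q - 1)]

theorem prod_ite_mul_half {d : ℕ} (I : Finset (Fin d)) (a : ℝ) :
    ∏ i, (if i ∈ I then a else 1) * (1 / 2) = a ^ I.card * (1 / 2) ^ d := by
  rw [Finset.prod_mul_distrib, Finset.prod_ite_mem, Finset.univ_inter, Finset.prod_const,
    Finset.prod_const, Finset.card_univ, Fintype.card_fin]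

/-- The probability of a spin with mean `m` (on the coordinates in `I`; uniform otherwise). -/
noncomputable def biasedSpin {d : ℕ} (I : Finset (Fin d)) (m : ℝ) (i : Fin d) (u : ℤˣ) : ℝ :=
  (1 + ((u : ℤ) : ℝ) * (if i ∈ I then m else 0)) / 2

/-- The exponential weight of a spin in the field `w` (on the coordinates in `I`). -/
noncomputable def tiltedSpin {d : ℕ} (I : Finset (Fin d)) (w : ℝ) (i : Fin d) (u : ℤˣ) : ℝ :=
  Real.exp (if i ∈ I then ((u : ℤ) : ℝ) * w - w ^ 2 / 2 else 0) / 2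

theorem exp_sub_half_sq (w : ℝ) :
    Real.exp (w - w ^ 2 / 2) = Real.exp (-(w ^ 2 / 2)) * Real.cosh w +
      Real.exp (-(w ^ 2 / 2)) * Real.sinh w := by
  rw [← mul_add, Real.cosh_add_sinh, ← Real.exp_add]
  congr 1
  ring

/-- The squared distance of the two weights, for a given value of the field. -/
theorem sum_sq_prod_sub_prod_le {d : ℕ} (I : Finset (Fin d)) {w m : ℝ} (hm : |m| ≤ |w|)
    (hmw : |m - w| ≤ |w| ^ 3) :
    ∑ x : Fin d → ℤˣ, (∏ i, biasedSpin I m i (x i) - ∏ i, tiltedSpin I w i (x i)) ^ 2 ≤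
      (1 / 2) ^ d * (Real.exp (I.card * w ^ 2) *
        (3 * I.card * w ^ 6 + 9 * I.card ^ 2 * w ^ 8)) := by
  obtain ⟨c, hc⟩ : ∃ c, c = Real.exp (-(w ^ 2 / 2)) * Real.cosh w := ⟨_, rfl⟩
  obtain ⟨q, hq⟩ : ∃ q, q = Real.exp (-(w ^ 2 / 2)) * Real.sinh w := ⟨_, rfl⟩
  have hp : Real.exp (w - w ^ 2 / 2) = c + q := by rw [exp_sub_half_sq, hc, hq]
  have hn : Real.exp (-w - w ^ 2 / 2) = c - q := by
    have := exp_sub_half_sq (-w)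
    rw [neg_sq, Real.cosh_neg, Real.sinh_neg] at this
    rw [this, hc, hq]
    ring
  have h1 : ∀ x : Fin d → ℤˣ,
      (∏ i, biasedSpin I m i (x i) - ∏ i, tiltedSpin I w i (x i)) ^ 2 =
        ∏ i, biasedSpin I m i (x i) ^ 2 -
          2 * ∏ i, biasedSpin I m i (x i) * tiltedSpin I w i (x i) +
          ∏ i, tiltedSpin I w i (x i) ^ 2 := fun x => by
    rw [Finset.prod_pow, Finset.prod_pow, Finset.prod_mul_distrib]
    ring
  simp only [h1, Finset.sum_add_distrib, Finset.sum_sub_distrib, ← Finset.mul_sum]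
  rw [sum_pi_prod (fun i u => biasedSpin I m i u ^ 2),
    sum_pi_prod (fun i u => biasedSpin I m i u * tiltedSpin I w i u),
    sum_pi_prod (fun i u => tiltedSpin I w i u ^ 2)]
  have e1 : ∀ i, ∑ u, biasedSpin I m i u ^ 2 = (if i ∈ I then 1 + m ^ 2 else 1) * (1 / 2) :=
    fun i => by
      by_cases hi : i ∈ I <;> simp [biasedSpin, hi] <;> ring
  have e2 : ∀ i, ∑ u, biasedSpin I m i u * tiltedSpin I w i u =
      (if i ∈ I then c + m * q else 1) * (1 / 2) := fun i => by
    by_cases hi : i ∈ I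
    · simp [biasedSpin, tiltedSpin, hi, hp, hn]
      ring
    · simp [biasedSpin, tiltedSpin, hi]
  have e3 : ∀ i, ∑ u, tiltedSpin I w i u ^ 2 = (if i ∈ I then c ^ 2 + q ^ 2 else 1) * (1 / 2) :=
    fun i => by
      by_cases hi : i ∈ I
      · simp [tiltedSpin, hi, hp, hn]
        ring
      · simp [tiltedSpin, hi]
        norm_num
  simp only [e1, e2, e3, prod_ite_mul_half]
  calc _ = (1 / 2) ^ d * ((1 + m ^ 2) ^ I.card - 2 * (c + m * q) ^ I.card +
        (c ^ 2 + q ^ 2) ^ I.card) := by ring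
    _ ≤ _ := by
      gcongr
      exact pow_sub_two_pow_add_pow_le hm hmw _ hc hq

theorem sum_prod_tiltedSpin_le {d : ℕ} (I : Finset (Fin d)) (w : ℝ) :
    ∑ x : Fin d → ℤˣ, ∏ i, tiltedSpin I w i (x i) ≤ 1 := by
  rw [sum_pi_prod (fun i u => tiltedSpin I w i u)]
  refine Finset.prod_le_one (fun i _ => Finset.sum_nonneg fun u _ => ?_) fun i _ => ?_
  · rw [tiltedSpin]; positivity
  · by_cases hi : i ∈ I
    · have hp := exp_sub_half_sq w
      have hn := exp_sub_half_sq (-w)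
      rw [neg_sq, Real.cosh_neg, Real.sinh_neg] at hn
      have := (exp_mul_cosh_mem w).2
      simp [tiltedSpin, hi, hp, hn]
      linarith
    · simp [tiltedSpin, hi]

theorem prod_tiltedSpin {d : ℕ} (I : Finset (Fin d)) (w : ℝ) (x : Fin d → ℤˣ) :
    ∏ i, tiltedSpin I w i (x i) = (1 / 2) ^ d *
      Real.exp ((∑ i ∈ I, ((x i : ℤ) : ℝ)) * w - I.card * (w ^ 2 / 2)) := by
  simp only [tiltedSpin, div_eq_mul_one_div (Real.exp _)]
  rw [Finset.prod_mul_distrib, ← Real.exp_sum, Finset.sum_ite_mem, Finset.univ_inter,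
    Finset.sum_sub_distrib, ← Finset.sum_mul]
  simp [mul_comm]

theorem prod_tiltedSpin_nonneg {d : ℕ} (I : Finset (Fin d)) (w : ℝ) (x : Fin d → ℤˣ) :
    0 ≤ ∏ i, tiltedSpin I w i (x i) :=
  Finset.prod_nonneg fun i _ => by rw [tiltedSpin]; positivity

theorem abs_prod_tiltedSpin_le {d : ℕ} (I : Finset (Fin d)) (w : ℝ) (x : Fin d → ℤˣ) :
    |∏ i, tiltedSpin I w i (x i)| ≤ 1 := by
  rw [abs_of_nonneg (prod_tiltedSpin_nonneg I w x)]
  exact (Finset.single_le_sum (f := fun y : Fin d → ℤˣ => ∏ i, tiltedSpin I w i (y i))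
    (fun y _ => prod_tiltedSpin_nonneg I w y) (Finset.mem_univ x)).trans
    (sum_prod_tiltedSpin_le I w)

theorem abs_prod_biasedSpin_le {d : ℕ} (I : Finset (Fin d)) {m : ℝ} (hm : |m| ≤ 1)
    (x : Fin d → ℤˣ) : |∏ i, biasedSpin I m i (x i)| ≤ 1 := by
  rw [Finset.abs_prod]
  refine Finset.prod_le_one (fun i _ => abs_nonneg _) fun i _ => ?_
  rw [abs_le] at hm ⊢
  rcases Int.units_eq_one_or (x i) with h | h <;> by_cases hi : i ∈ I <;>
    simp [biasedSpin, h, hi] <;> constructor <;> linarith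

theorem sq_integral_le_integral_sq {Ω : Type*} [MeasurableSpace Ω] {μ : Measure Ω}
    [IsProbabilityMeasure μ] {f : Ω → ℝ} (hf : MemLp f 2 μ) :
    (∫ ω, f ω ∂μ) ^ 2 ≤ ∫ ω, f ω ^ 2 ∂μ := by
  have h := variance_nonneg f μ
  rw [variance_eq_sub hf] at h
  simpa using h

theorem indicatorVec_mul_self {d : ℕ} (I : Finset (Fin d)) (m : ℝ → ℝ) (hm : m 0 = 0) (a : ℝ)
    (i : Fin d) : m (a * indicatorVec I i) = if i ∈ I then m a else 0 := by
  by_cases hi : i ∈ I <;> simp [indicatorVec, hi, hm]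

/-- The Gaussian moment `E[exp (g ^ 2 / 4) g ^ k]`. -/
noncomputable def momentBound (k : ℕ) : ℝ :=
  ∫ g, Real.exp (g ^ 2 / 4) * g ^ k ∂gaussianReal 0 1

theorem momentBound_nonneg {k : ℕ} (hk : Even k) : 0 ≤ momentBound k :=
  integral_nonneg fun g => mul_nonneg (Real.exp_pos _).le (hk.pow_nonneg g)

/-- The chi-square divergence between the law of the signs of a Gaussian vector with spiked
covariance and the Ising model on a clique. -/
theorem chiSq_signVec_ising_le {d : ℕ} (I : Finset (Fin d)) {τ : ℝ} (hτ : 0 ≤ τ)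
    (h : I.card * τ ≤ 1 / 4) :
    ∑ x, ((multivariateGaussian 0 (1 + (Real.pi / 2 * τ) •
        Matrix.vecMulVec (indicatorVec I) (indicatorVec I))).map signVec).real {x} ^ 2 /
      (isingMeasure (cliqueMatrix I (τ / (2 * (1 + I.card * τ))))).real {x} ≤
    1 + 2 * (3 * I.card * τ ^ 3 * momentBound 6 + 9 * I.card ^ 2 * τ ^ 4 * momentBound 8) := by
  obtain ⟨s, hs⟩ : ∃ s : ℝ, s = I.card := ⟨_, rfl⟩
  rw [← hs] at h ⊢
  have hs0 : 0 ≤ s := by rw [hs]; positivity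
  obtain ⟨θ, hθ⟩ : ∃ θ, θ = τ / (2 * (1 + s * τ)) := ⟨_, rfl⟩
  have hθ0 : 0 ≤ θ := by rw [hθ]; positivity
  rw [← hθ]
  obtain ⟨r, hr⟩ : ∃ r, r = √(Real.pi / 2 * τ) := ⟨_, rfl⟩
  have hr2 : Real.pi / 2 * τ = r ^ 2 := by
    have := Real.pi_pos
    rw [hr, Real.sq_sqrt (by positivity)]
  -- The factor `π / 2` in the spike is chosen so that the linear part of the mean sign is exactly
  -- the Ising field.
  have hrw : ∀ g, √(2 / Real.pi) * (r * g) = √τ * g := fun g => by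
    have := Real.pi_pos
    rw [hr, ← mul_assoc, ← Real.sqrt_mul (by positivity)]
    congr 2
    field_simp
  set γ := gaussianReal 0 1 with hγ
  set A : (Fin d → ℤˣ) → ℝ → ℝ := fun x g => ∏ i, biasedSpin I (signMean (r * g)) i (x i) with hA
  set B : (Fin d → ℤˣ) → ℝ → ℝ := fun x g => ∏ i, tiltedSpin I (√τ * g) i (x i) with hB
  set P : (Fin d → ℤˣ) → ℝ := fun x => ∫ g, A x g ∂γ with hP
  set F : (Fin d → ℤˣ) → ℝ := fun x => ∫ g, B x g ∂γ with hF
  have hAm : ∀ x, Measurable (A x) := fun x => by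
    have := measurable_signMean
    refine Finset.measurable_prod _ fun i _ => ?_
    by_cases hi : i ∈ I <;> simp only [biasedSpin, hi, if_true, if_false] <;> fun_prop
  have hBm : ∀ x, Measurable (B x) := fun x => by
    refine Finset.measurable_prod _ fun i _ => ?_
    by_cases hi : i ∈ I <;> simp only [tiltedSpin, hi, if_true, if_false] <;> fun_prop
  have hAb : ∀ x g, |A x g| ≤ 1 := fun x g => abs_prod_biasedSpin_le I (abs_signMean_le_one _) x
  have hBb : ∀ x g, |B x g| ≤ 1 := fun x g => abs_prod_tiltedSpin_le I _ x
  have hAL : ∀ x, MemLp (A x) 2 γ := fun x =>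
    MemLp.of_bound (hAm x).aestronglyMeasurable 1 (ae_of_all _ (hAb x))
  have hBL : ∀ x, MemLp (B x) 2 γ := fun x =>
    MemLp.of_bound (hBm x).aestronglyMeasurable 1 (ae_of_all _ (hBb x))
  have hAi : ∀ x, Integrable (A x) γ := fun x => (hAL x).integrable (by norm_num)
  have hBi : ∀ x, Integrable (B x) γ := fun x => (hBL x).integrable (by norm_num)
  have hDi : ∀ x, Integrable (fun g => (A x g - B x g) ^ 2) γ := fun x =>
    ((hAL x).sub (hBL x)).integrable_sq
  -- the law of the signs
  have hPlaw : ∀ x, ((multivariateGaussian 0 (1 + (Real.pi / 2 * τ) •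
      Matrix.vecMulVec (indicatorVec I) (indicatorVec I))).map signVec).real {x} = P x := fun x => by
    rw [hr2, map_signVec_spiked]
    refine integral_congr_ae (ae_of_all _ fun g => ?_)
    simp only [hA, biasedSpin, indicatorVec_mul_self I signMean signMean_zero]
  have hP1 : ∑ x, P x = 1 := by
    simp only [← hPlaw]
    have := Measure.isProbabilityMeasure_map (μ := multivariateGaussian 0 (1 + (Real.pi / 2 * τ) •
      Matrix.vecMulVec (indicatorVec I) (indicatorVec I)))
      (measurable_signVec (d := d)).aemeasurable
    rw [sum_measureReal_singleton]
    simp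
  -- the weights of the Ising model
  have hb : 0 < 1 + s * τ := by positivity
  have hFeq : ∀ x, F x = (1 / 2) ^ d * ((√(1 + s * τ))⁻¹ *
      Real.exp (θ * (∑ i ∈ I, ((x i : ℤ) : ℝ)) ^ 2)) := fun x => by
    simp only [hF, hB, prod_tiltedSpin]
    rw [integral_const_mul, integral_exp_gaussianReal hτ, ← hs, ← hθ]
  -- Each weight is at least half the uniform one, so the chi-square denominators can be replaced by
  -- a constant.
  have hFlow : ∀ x, (1 / 2) ^ d * (1 / 2) ≤ F x := fun x => by
    rw [hFeq]
    have h1 : 1 / 2 ≤ (√(1 + s * τ))⁻¹ := by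
      rw [one_div]
      have : √(1 + s * τ) ≤ 2 := Real.sqrt_le_iff.2 ⟨by norm_num, by linarith⟩
      gcongr
    have h2 : 1 ≤ Real.exp (θ * (∑ i ∈ I, ((x i : ℤ) : ℝ)) ^ 2) :=
      Real.one_le_exp (by positivity)
    have h3 := mul_le_mul h1 h2 zero_le_one (by positivity)
    rw [mul_one] at h3
    gcongr
  have hFpos : ∀ x, 0 < F x := fun x => lt_of_lt_of_le (by positivity) (hFlow x)
  have hF1 : ∑ x, F x ≤ 1 := by
    simp only [hF]
    rw [← integral_finsetSum _ fun x _ => hBi x]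
    refine (integral_mono (g := fun _ => (1 : ℝ)) (integrable_finsetSum _ fun x _ => hBi x)
      (integrable_const _) fun g => sum_prod_tiltedSpin_le I _).trans ?_
    simp
  have hQ : ∀ x, (isingMeasure (cliqueMatrix I θ)).real {x} = F x / ∑ y, F y := fun x => by
    have h1 : ∀ y, F y = ((1 / 2) ^ d * (√(1 + s * τ))⁻¹ * Real.exp (θ * s)) *
        isingWeight (cliqueMatrix I θ) y := fun y => by
      rw [hFeq, isingWeight_cliqueMatrix, mul_assoc _ (Real.exp (θ * s)), ← Real.exp_add]
      simp only [← hs]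
      ring_nf
    rw [isingMeasure_real_singleton, partitionFunction]
    simp only [h1, ← Finset.mul_sum]
    rw [mul_div_mul_left]
    positivity
  -- the divergence
  simp only [hPlaw, hQ]
  refine (sum_sq_div_normalized_le hP1 hFpos hF1).trans (add_le_add_right ?_ _)
  -- Both mixtures use the same `g`, so Jensen's inequality reduces the comparison to fixed `g`.
  have h1 : ∀ x, (P x - F x) ^ 2 / F x ≤ 2 * 2 ^ d * ∫ g, (A x g - B x g) ^ 2 ∂γ := fun x => by
    have e1 : (P x - F x) ^ 2 ≤ ∫ g, (A x g - B x g) ^ 2 ∂γ := by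
      simp only [hP, hF]
      rw [← integral_sub (hAi x) (hBi x)]
      exact sq_integral_le_integral_sq ((hAL x).sub (hBL x))
    calc _ ≤ (P x - F x) ^ 2 / ((1 / 2) ^ d * (1 / 2)) := by
          gcongr; exact hFlow x
      _ = 2 * 2 ^ d * (P x - F x) ^ 2 := by
        rw [one_div, inv_pow]
        field_simp
      _ ≤ _ := by gcongr
  refine (Finset.sum_le_sum fun x _ => h1 x).trans ?_
  rw [← Finset.mul_sum, ← integral_finsetSum _ fun x _ => hDi x]
  have h2 : ∀ g, ∑ x, (A x g - B x g) ^ 2 ≤ (1 / 2) ^ d *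
      (3 * s * τ ^ 3 * (Real.exp (g ^ 2 / 4) * g ^ 6) +
        9 * s ^ 2 * τ ^ 4 * (Real.exp (g ^ 2 / 4) * g ^ 8)) := fun g => by
    have hb := signMean_bounds (r * g)
    rw [hrw] at hb
    refine (sum_sq_prod_sub_prod_le I hb.1 hb.2).trans ?_
    have hw : (√τ * g) ^ 2 = τ * g ^ 2 := by rw [mul_pow, Real.sq_sqrt hτ]
    have hw6 : (√τ * g) ^ 6 = τ ^ 3 * g ^ 6 := by
      rw [show (6 : ℕ) = 2 * 3 from rfl, pow_mul, hw]; ring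
    have hw8 : (√τ * g) ^ 8 = τ ^ 4 * g ^ 8 := by
      rw [show (8 : ℕ) = 2 * 4 from rfl, pow_mul, hw]; ring
    rw [hw, hw6, hw8, ← hs]
    have he : Real.exp (s * (τ * g ^ 2)) ≤ Real.exp (g ^ 2 / 4) := by
      rw [Real.exp_le_exp]
      nlinarith [mul_le_mul_of_nonneg_right h (sq_nonneg g)]
    have hpos : 0 ≤ 3 * s * (τ ^ 3 * g ^ 6) + 9 * s ^ 2 * (τ ^ 4 * g ^ 8) := by
      have := (show Even 6 by decide).pow_nonneg g
      have := (show Even 8 by decide).pow_nonneg g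
      positivity
    refine mul_le_mul_of_nonneg_left ((mul_le_mul_of_nonneg_right he hpos).trans
      (le_of_eq (by ring))) (by positivity)
  have hi6 := (integrable_exp_mul_pow_gaussianReal 6).const_mul (3 * s * τ ^ 3)
  have hi8 := (integrable_exp_mul_pow_gaussianReal 8).const_mul (9 * s ^ 2 * τ ^ 4)
  have h3 := integral_mono (integrable_finsetSum _ fun x _ => hDi x)
    ((hi6.add hi8).const_mul ((1 / 2) ^ d)) h2
  rw [integral_const_mul, integral_add' hi6 hi8, integral_const_mul, integral_const_mul] at h3
  calc _ ≤ 2 * 2 ^ d * ((1 / 2) ^ d * (3 * s * τ ^ 3 * momentBound 6 +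
        9 * s ^ 2 * τ ^ 4 * momentBound 8)) := by gcongr; exact h3
    _ = 2 * (2 ^ d * (1 / 2) ^ d) * (3 * s * τ ^ 3 * momentBound 6 +
        9 * s ^ 2 * τ ^ 4 * momentBound 8) := by ring
    _ = _ := by rw [← mul_pow]; norm_num

/-! ### Comparison of the risks -/

theorem gaussianSample_sign {n d : ℕ} (S : Matrix (Fin d) (Fin d) ℝ)
    (ψ : (Fin n → Fin d → ℤˣ) → Bool) (b : Bool) :
    gaussianSample S n {z | ψ (fun i j => realSign (z i j)) = b} =
      (Measure.pi fun _ : Fin n => (multivariateGaussian 0 S).map signVec) {x | ψ x = b} := by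
  have := Measure.isProbabilityMeasure_map (μ := multivariateGaussian 0 S)
    (measurable_signVec (d := d)).aemeasurable
  have h : ∀ _ : Fin n, AEMeasurable (signVec (d := d)) (multivariateGaussian 0 S) := fun _ =>
    measurable_signVec.aemeasurable
  have hm : Measurable fun (z : Fin n → EuclideanSpace ℝ (Fin d)) i => signVec (z i) :=
    measurable_pi_lambda _ fun i => measurable_signVec.comp (measurable_pi_apply i)
  rw [← Measure.pi_map_pi h, Measure.map_apply hm (Set.toFinite _).measurableSet]
  rfl

/-- The signs of spiked Gaussian samples compared to samples from the Ising model. -/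
theorem gaussianSample_le_isingSample {d : ℕ} (I : Finset (Fin d)) {τ : ℝ} (hτ : 0 ≤ τ)
    (h : I.card * τ ≤ 1 / 4) (n : ℕ) (ψ : (Fin n → Fin d → ℤˣ) → Bool) (b : Bool) :
    gaussianSample (1 + (Real.pi / 2 * τ) •
        Matrix.vecMulVec (indicatorVec I) (indicatorVec I)) n
        {z | ψ (fun i j => realSign (z i j)) = b} ≤
      isingSample (cliqueMatrix I (τ / (2 * (1 + I.card * τ)))) n {x | ψ x = b} +
        ENNReal.ofReal √((1 + 2 * (3 * I.card * τ ^ 3 * momentBound 6 +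
          9 * I.card ^ 2 * τ ^ 4 * momentBound 8)) ^ n - 1) := by
  rw [gaussianSample_sign]
  have := Measure.isProbabilityMeasure_map (μ := multivariateGaussian 0 (1 + (Real.pi / 2 * τ) •
    Matrix.vecMulVec (indicatorVec I) (indicatorVec I))) (measurable_signVec (d := d)).aemeasurable
  have h1 := pi_measureReal_le _ (isingMeasure (cliqueMatrix I (τ / (2 * (1 + I.card * τ)))))
    (fun x => by
      rw [isingMeasure_real_singleton]
      exact div_pos (isingWeight_pos _ x) (partitionFunction_pos _))
    (chiSq_signVec_ising_le I hτ h) n {x | ψ x = b}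
  rw [isingSample]
  rw [← ofReal_measureReal, ← ofReal_measureReal (μ := Measure.pi fun _ =>
    isingMeasure (cliqueMatrix I (τ / (2 * (1 + I.card * τ))))),
    ← ENNReal.ofReal_add measureReal_nonneg (Real.sqrt_nonneg _)]
  exact ENNReal.ofReal_le_ofReal h1

/-- The signs of a standard Gaussian sample are uniform. -/
theorem gaussianSample_one_le {n d : ℕ} (ψ : (Fin n → Fin d → ℤˣ) → Bool) (b : Bool) :
    gaussianSample 1 n {z | ψ (fun i j => realSign (z i j)) = b} ≤
      isingSample 0 n {x | ψ x = b} := by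
  -- The empty clique with `τ = 0`: spike, interaction and error all vanish.
  have h := gaussianSample_le_isingSample (∅ : Finset (Fin d)) le_rfl (by simp) n ψ b
  simpa [cliqueMatrix_empty] using h

/-- The risk of a test for spins in the Ising model is at least its risk for the signs of Gaussian
data, up to an error controlled by the chi-square divergence. -/
theorem pcaRisk_sign_le {n d s : ℕ} {τ : ℝ} (hτ : 0 < τ) (h : s * τ ≤ 1 / 4)
    (ψ : (Fin n → Fin d → ℤˣ) → Bool) :
    pcaRisk s (Real.pi / 2 * τ) (fun z => ψ fun i j => realSign (z i j)) ≤
      isingRisk (⊤ : SimpleGraph (Fin s)) (τ / (2 * (1 + s * τ))) ψ +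
        ENNReal.ofReal √((1 + 2 * (3 * s * τ ^ 3 * momentBound 6 +
          9 * s ^ 2 * τ ^ 4 * momentBound 8)) ^ n - 1) := by
  rw [pcaRisk, isingRisk, add_assoc]
  refine add_le_add (gaussianSample_one_le ψ true) (iSup₂_le ?_)
  rintro S ⟨I, rfl, rfl⟩
  refine (gaussianSample_le_isingSample I hτ.le h n ψ false).trans (add_le_add_left ?_ _)
  refine le_iSup₂ (f := fun Θ (_ : Θ ∈ parameterSpace (graphsContaining
    (⊤ : SimpleGraph (Fin I.card)) d) (τ / (2 * (1 + I.card * τ)))) =>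
      isingSample Θ n {x | ψ x = false}) _ (cliqueMatrix_mem_parameterSpace I (by positivity) ?_)
  have hb : 0 < 1 + I.card * τ := by positivity
  rw [div_mul_eq_mul_div, div_le_iff₀ (by positivity)]
  linarith

/-- The field strength matching a given interaction. -/
theorem exists_fieldStrength {s : ℕ} {θ : ℝ} (hθ : 0 < θ) (h : s * θ ≤ 1 / 16) :
    ∃ τ, 0 < τ ∧ τ ≤ 3 * θ ∧ s * τ ≤ 1 / 4 ∧ τ / (2 * (1 + s * τ)) = θ := by
  have hp : 0 < 1 - 2 * (s * θ) := by linarith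
  have hτ : 2 * θ / (1 - 2 * (s * θ)) ≤ 3 * θ := by
    rw [div_le_iff₀ hp]
    nlinarith
  -- The solution of `τ = 2 * θ * (1 + s * τ)`.
  refine ⟨2 * θ / (1 - 2 * (s * θ)), by positivity, hτ, ?_, ?_⟩
  · calc s * (2 * θ / (1 - 2 * (s * θ))) ≤ s * (3 * θ) := by gcongr
      _ ≤ 1 / 4 := by linarith
  · have h1 : 1 + s * (2 * θ / (1 - 2 * (s * θ))) = 1 / (1 - 2 * (s * θ)) := by
      rw [eq_div_iff hp.ne', add_mul, mul_assoc, div_mul_cancel₀ _ hp.ne']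
      ring
    rw [h1, mul_one_div, div_div_div_cancel_right₀ hp.ne']
    ring

/-! ### Asymptotics of the error -/

theorem divergence_le {s : ℕ} {τ θ : ℝ} (hτ : 0 ≤ τ) (hτθ : τ ≤ 3 * θ) (h : s * τ ≤ 1 / 4) :
    2 * (3 * s * τ ^ 3 * momentBound 6 + 9 * s ^ 2 * τ ^ 4 * momentBound 8) ≤
      18 * (momentBound 6 + momentBound 8) * θ ^ 2 := by
  have h6 := momentBound_nonneg (k := 6) (by decide)
  have h8 := momentBound_nonneg (k := 8) (by decide)
  have hs : 0 ≤ s * τ := by positivity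
  calc _ = 2 * (3 * (s * τ) * momentBound 6 + 9 * (s * τ) ^ 2 * momentBound 8) * τ ^ 2 := by ring
    _ ≤ 2 * (3 * (1 / 4) * momentBound 6 + 9 * (1 / 4) ^ 2 * momentBound 8) * (3 * θ) ^ 2 := by
      gcongr
    _ ≤ 2 * (1 * momentBound 6 + 1 * momentBound 8) * (3 * θ) ^ 2 := by
      gcongr <;> norm_num
    _ = _ := by ring

theorem mul_signalLevel_le_one {δ : ℝ} (hδ : 0 < δ) (n : ℕ) {s : ℕ} (hs : 1 ≤ s) :
    s * signalLevel δ n s ≤ 1 := by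
  have hs' : (1 : ℝ) ≤ s := by exact_mod_cast hs
  calc s * signalLevel δ n s ≤ s * (s : ℝ) ^ (-(1 + δ)) := by
        gcongr; exact min_le_right _ _
    _ = (s : ℝ) ^ (-δ) := by
      rw [← Real.rpow_one_add' (by positivity) (by linarith)]
      congr 1; ring
    _ ≤ 1 := Real.rpow_le_one_of_one_le_of_nonpos hs' (by linarith)

/-- The margin `δ` above the exponent `1 / 2` is what makes the divergence of `n` samples vanish. -/
theorem mul_signalLevel_sq_le {δ : ℝ} {n : ℕ} (hn : 1 ≤ n) (s : ℕ) :
    n * signalLevel δ n s ^ 2 ≤ (n : ℝ) ^ (-(2 * δ)) := by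
  have hn' : (0 : ℝ) < n := by exact_mod_cast hn
  have h0 : 0 ≤ signalLevel δ n s := le_min (by positivity) (by positivity)
  calc n * signalLevel δ n s ^ 2 ≤ n * ((n : ℝ) ^ (-(1 / 2 + δ))) ^ 2 := by
        gcongr; exact min_le_left _ _
    _ = (n : ℝ) ^ (-(2 * δ)) := by
      rw [← Real.rpow_natCast ((n : ℝ) ^ (-(1 / 2 + δ))), ← Real.rpow_mul hn'.le]
      nth_rewrite 1 [← Real.rpow_one (n : ℝ)]
      rw [← Real.rpow_add hn']
      congr 1
      push_cast
      ring

theorem tendsto_error {δ : ℝ} (hδ : 0 < δ) (K : ℝ) :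
    Tendsto (fun n : ℕ => ENNReal.ofReal √(Real.exp (K * (n : ℝ) ^ (-(2 * δ))) - 1)) atTop
      (nhds 0) := by
  have h1 : Tendsto (fun n : ℕ => (n : ℝ) ^ (-(2 * δ))) atTop (nhds 0) :=
    (tendsto_rpow_neg_atTop (by linarith)).comp tendsto_natCast_atTop_atTop
  have h2 : Continuous fun y : ℝ => ENNReal.ofReal √(Real.exp (K * y) - 1) :=
    ENNReal.continuous_ofReal.comp (by fun_prop)
  have h3 := (h2.tendsto 0).comp h1
  simp only [mul_zero, Real.exp_zero, sub_self, Real.sqrt_zero, ENNReal.ofReal_zero] at h3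
  exact h3

end IsingDetection

theorem mainTheorem4 (δ : ℝ) (hδ : 0 < δ) (hPCA : IsingDetection.SparsePCAHardness δ) :
    ∃ η : ℝ, 0 < η ∧ ∀ (d s : ℕ → ℕ) (θ : ℕ → ℝ),
      (∀ n, 2 ≤ s n) →
      (fun n => (s n : ℝ)) =o[atTop] (fun n => √(d n : ℝ)) →
      (∀ᶠ n in atTop, 0 < θ n ∧ θ n ≤ η * IsingDetection.signalLevel δ n (s n)) →
      ∀ ψ : ∀ n, (Fin n → Fin (d n) → ℤˣ) → Bool, IsingDetection.IsPolyTimeSpinTest s ψ →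
        1 / 4 ≤ liminf (fun n => IsingDetection.isingRisk
          (⊤ : SimpleGraph (Fin (s n))) (θ n) (ψ n)) atTop := by
  open IsingDetection in
  obtain ⟨η₀, hη₀, hPCA⟩ := hPCA
  -- The spike is `π / 2 * τ ≤ 2 * (3 * θ) = 6 * θ`, whence `η₀ / 6`; the bound `1 / 16` ensures `s
  -- * θ ≤ 1 / 16`, as the choice of `τ` requires.
  refine ⟨min (η₀ / 6) (1 / 16), by positivity, fun d s θ hs hsd hθ ψ hψ => ?_⟩
  have hη1 : min (η₀ / 6) (1 / 16) ≤ η₀ / 6 := min_le_left _ _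
  have hη2 : min (η₀ / 6) (1 / 16) ≤ 1 / 16 := min_le_right _ _
  have hη0 : 0 < min (η₀ / 6) (1 / 16) := by positivity
  generalize min (η₀ / 6) (1 / 16) = η at *
  have hex : ∀ n, ∃ τ, 0 < θ n ∧ θ n ≤ η * signalLevel δ n (s n) →
      0 < τ ∧ τ ≤ 3 * θ n ∧ s n * τ ≤ 1 / 4 ∧ τ / (2 * (1 + s n * τ)) = θ n := fun n => by
    by_cases h : 0 < θ n ∧ θ n ≤ η * signalLevel δ n (s n)
    · obtain ⟨τ, hτ⟩ := exists_fieldStrength (s := s n) h.1 (by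
        have h1 := mul_signalLevel_le_one hδ n (one_le_two.trans (hs n))
        calc s n * θ n ≤ s n * (η * signalLevel δ n (s n)) := by gcongr; exact h.2
          _ = η * (s n * signalLevel δ n (s n)) := by ring
          _ ≤ η * 1 := by gcongr
          _ ≤ 1 / 16 := by linarith)
      exact ⟨τ, fun _ => hτ⟩
    · exact ⟨0, fun h' => absurd h' h⟩
  choose τ hτ using hex
  have hmain := hPCA d s (fun n => Real.pi / 2 * τ n) (fun n => one_le_two.trans (hs n)) hsd
    (hθ.mono fun n h => by
      obtain ⟨h1, h2, -, -⟩ := hτ n h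
      have hpi := Real.pi_pos
      refine ⟨by positivity, ?_⟩
      have h0 : 0 ≤ signalLevel δ n (s n) := le_min (by positivity) (by positivity)
      calc Real.pi / 2 * τ n ≤ 4 / 2 * (3 * (η * signalLevel δ n (s n))) := by
            gcongr
            · exact Real.pi_le_four
            · exact h2.trans (by linarith [h.2])
        _ = 6 * η * signalLevel δ n (s n) := by ring
        _ ≤ η₀ * signalLevel δ n (s n) := by gcongr; linarith)
    _ hψ.comp_sign
  set K : ℝ := 18 * (momentBound 6 + momentBound 8) * η ^ 2 with hK
  have h6 := momentBound_nonneg (k := 6) (by decide)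
  have h8 := momentBound_nonneg (k := 8) (by decide)
  -- Adding a null sequence leaves the lower limit unchanged, so the risks need only be compared up
  -- to this error.
  rw [← ENNReal.liminf_add_of_right_tendsto_zero (tendsto_error hδ K)]
  refine hmain.trans (liminf_le_liminf ?_)
  filter_upwards [hθ, eventually_ge_atTop 1] with n h hn
  obtain ⟨h1, h2, h3, h4⟩ := hτ n h
  refine (pcaRisk_sign_le h1 h3 (ψ n)).trans ?_
  rw [h4]
  refine add_le_add_right (ENNReal.ofReal_le_ofReal (Real.sqrt_le_sqrt (sub_le_sub_right ?_ _))) _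
  set χ := 2 * (3 * s n * τ n ^ 3 * momentBound 6 + 9 * s n ^ 2 * τ n ^ 4 * momentBound 8) with hχ
  have hχ0 : 0 ≤ χ := by
    rw [hχ]
    positivity
  have hχn : n * χ ≤ K * (n : ℝ) ^ (-(2 * δ)) := by
    have h0 := h.1.le
    calc n * χ ≤ n * (18 * (momentBound 6 + momentBound 8) *
          (η * signalLevel δ n (s n)) ^ 2) := by
          gcongr
          refine (divergence_le h1.le h2 h3).trans ?_
          gcongr
          exact h.2
      _ = K * (n * signalLevel δ n (s n) ^ 2) := by rw [hK]; ring
      _ ≤ _ := by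
        gcongr
        exact mul_signalLevel_sq_le hn _
  calc (1 + χ) ^ n ≤ Real.exp χ ^ n := by
        gcongr
        rw [add_comm]; exact Real.add_one_le_exp χ
    _ = Real.exp (n * χ) := (Real.exp_nat_mul χ n).symm
    _ ≤ _ := Real.exp_le_exp.2 hχn
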